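/- Let $k\ge 1$ be an integer, $0<\epsilon\le 1$, and let $m$ be a real number with $1\le m\le k$. Let $p,q$ be two atomless (continuous) probability distributions on $\mathbb{R}$ consisting of $k$ consecutive buckets, where a bucket is an interval made up of a mini-bucket followed by an interval on which $p=q$ and on which both $p$ and $q$ have total mass $(1-\epsilon)/k$, and a mini-bucket is an interval $I$ that can be divided into three subintervals $I_1,I_2,I_3$, in this order, with $p(I_1)=p(I_3)=\epsilon/(2k)$, $p(I_2)=0$, $q(I_1)=q(I_3)=0$ and $q(I_2)=\epsilon/k$. Let $r$ be any atomless probability distribution on $\mathbb{R}$. Let $X$ be uniform in $\{0,1\}$. If $X=0$, the pair of distributions to be sampled is $(p,q)$; if $X=1$, it is $(r,r)$, i.e. the two distributions are equal. Given $X$, draw $m'\sim\mathrm{Poi}(m)$ independent samples from the first distribution of the pair and, independently, $m''\sim\mathrm{Poi}(m)$ independent samples from the second one. Let $Y$ be the ordered sequence of labels obtained by listing all $m'+m''$ samples in increasing order of their values and recording for each only whether it came from the first or from the second distribution. Theorem. There is an absolute constant $C>0$ such that, for all such $k,\epsilon,m,p,q,r$, the mutual information of $X$ and $Y$ satisfies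 $$ I(X:Y)\;\le\; C\,\frac{m^5\epsilon^6}{k^4}. $$ -/

import Mathlib

open MeasureTheory ProbabilityTheory Set
open scoped ENNReal NNReal

/-- Label sequences form a countable set and carry the discrete σ-algebra. -/
instance instMeasurableSpaceListBool : MeasurableSpace (List Bool) := ⊤

instance instDiscreteMeasurableSpaceListBool : DiscreteMeasurableSpace (List Bool) :=
  ⟨fun _ => trivial⟩

/-- The interval `(a, b]` is a mini-bucket for `(p, q)`: it splits into three consecutive
subintervals of masses `ε/(2k), 0, ε/(2k)` under `p` and `0, ε/k, 0` under `q`. -/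
def IsMiniBucket (k : ℕ) (ε : ℝ) (p q : Measure ℝ) (a b : ℝ) : Prop :=
  ∃ u v : ℝ, a ≤ u ∧ u ≤ v ∧ v ≤ b ∧
    p (Ioc a u) = ENNReal.ofReal (ε / (2 * k)) ∧ q (Ioc a u) = 0 ∧
    p (Ioc u v) = 0 ∧ q (Ioc u v) = ENNReal.ofReal (ε / k) ∧
    p (Ioc v b) = ENNReal.ofReal (ε / (2 * k)) ∧ q (Ioc v b) = 0

/-- The interval `(a, b]` is a bucket for `(p, q)`: a mini-bucket `(a, c]` followed by an interval
`(c, b]` on which `p = q` and on which both have total mass `(1 - ε)/k`. -/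
def IsBucket (k : ℕ) (ε : ℝ) (p q : Measure ℝ) (a b : ℝ) : Prop :=
  ∃ c : ℝ, a ≤ c ∧ c ≤ b ∧ IsMiniBucket k ε p q a c ∧
    p.restrict (Ioc c b) = q.restrict (Ioc c b) ∧
    p (Ioc c b) = ENNReal.ofReal ((1 - ε) / k)

/-- `p` and `q` consist of `k` consecutive buckets. For probability measures the buckets carry the
whole mass, since each of them has mass `1/k`. -/
def IsBucketPair (k : ℕ) (ε : ℝ) (p q : Measure ℝ) : Prop :=
  ∃ a : Fin (k + 1) → ℝ, ∀ j : Fin k, IsBucket k ε p q (a j.castSucc) (a j.succ)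

/-- The sequence of labels obtained by merging the samples `x` (label `true`, drawn from `p`) with
the samples `y` (label `false`, drawn from `q`) in increasing order of their values. -/
noncomputable def orderPattern {n₁ n₂ : ℕ} (x : Fin n₁ → ℝ) (y : Fin n₂ → ℝ) : List Bool :=
  List.ofFn fun i : Fin (n₁ + n₂) =>
    Fin.append (fun _ : Fin n₁ => true) (fun _ : Fin n₂ => false)
      (Tuple.sort (Fin.append x y) i)

/-- The law of the order pattern of `n₁` independent samples from `p` and `n₂` independent samples
from `q`. -/
noncomputable def fixedSizeLaw (p q : Measure ℝ) (n₁ n₂ : ℕ) : Measure (List Bool) :=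
  ((Measure.pi fun _ : Fin n₁ => p).prod (Measure.pi fun _ : Fin n₂ => q)).map
    fun z => orderPattern z.1 z.2

/-- The law of the order pattern of `m' ∼ Poi(m)` samples from `p` and `m'' ∼ Poi(m)` samples from
`q`, with `m'`, `m''` and all samples independent. -/
noncomputable def orderLaw (m : ℝ≥0) (p q : Measure ℝ) : Measure (List Bool) :=
  ((poissonMeasure m).prod (poissonMeasure m)).bind fun n => fixedSizeLaw p q n.1 n.2

/-- The joint law of `(X, Y)`: `X` is uniform in `{0, 1}`; given `X = 0`, `Y` is the order pattern
of the Poissonized samples from the pair `(p, q)`; given `X = 1`, that from the pair `(r, r)`. -/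
noncomputable def jointLaw (m : ℝ≥0) (p q r : Measure ℝ) : Measure (Fin 2 × List Bool) :=
  (2⁻¹ : ℝ≥0∞) • (Measure.dirac 0).prod (orderLaw m p q) +
    (2⁻¹ : ℝ≥0∞) • (Measure.dirac 1).prod (orderLaw m r r)

/-- The mutual information (in nats) of the two coordinates of a pair with joint law `μ`. -/
noncomputable def mutualInfo {α β : Type*} [MeasurableSpace α] [MeasurableSpace β]
    (μ : Measure (α × β)) : ℝ≥0∞ :=
  InformationTheory.klDiv μ (μ.fst.prod μ.snd)

lemma measurableSet_sort_eq {n : ℕ} (σ : Equiv.Perm (Fin n)) :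
    MeasurableSet {z : Fin n → ℝ | Tuple.sort z = σ} := by
  have h : {z : Fin n → ℝ | Tuple.sort z = σ} =
      (⋂ i : Fin n, ⋂ j : Fin n, ⋂ _ : i ≤ j, {z : Fin n → ℝ | z (σ i) ≤ z (σ j)}) ∩
      (⋂ i : Fin n, ⋂ j : Fin n, ⋂ _ : i < j, ⋂ _ : ¬ σ i < σ j,
        {z : Fin n → ℝ | z (σ i) = z (σ j)}ᶜ) := by
    ext z
    simp only [mem_ofPred_eq, mem_inter_iff, mem_iInter, mem_compl_iff]
    rw [eq_comm, Tuple.eq_sort_iff]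
    refine and_congr ⟨fun h i j hij => h hij, fun h i j hij => h i j hij⟩ ?_
    exact ⟨fun h i j hij hn he => hn (h i j hij he),
      fun h i j hij he => by_contra fun hn => h i j hij hn he⟩
  rw [h]
  refine MeasurableSet.inter ?_ ?_
  · exact .iInter fun i => .iInter fun j => .iInter fun _ =>
      measurableSet_le (measurable_pi_apply _) (measurable_pi_apply _)
  · exact .iInter fun i => .iInter fun j => .iInter fun _ => .iInter fun _ =>
      (measurableSet_eq_fun (f := fun z : Fin n → ℝ => z (σ _)) (g := fun z => z (σ _))
        (measurable_pi_apply _) (measurable_pi_apply _)).compl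

/-- The order pattern is a measurable function of the samples, so that `fixedSizeLaw` is the honest
push-forward. -/
lemma measurable_orderPattern (n₁ n₂ : ℕ) :
    Measurable fun z : (Fin n₁ → ℝ) × (Fin n₂ → ℝ) => orderPattern z.1 z.2 := by
  have happ : Measurable fun z : (Fin n₁ → ℝ) × (Fin n₂ → ℝ) => Fin.append z.1 z.2 := by
    refine measurable_pi_lambda _ fun i => ?_
    induction i using Fin.addCases with
    | left i => simp only [Fin.append_left]; fun_prop
    | right i => simp only [Fin.append_right]; fun_prop
  let : MeasurableSpace (Equiv.Perm (Fin (n₁ + n₂))) := ⊤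
  have hsort : Measurable fun z : Fin (n₁ + n₂) → ℝ => Tuple.sort z :=
    measurable_to_countable' fun σ => measurableSet_sort_eq σ
  have hg : Measurable fun σ : Equiv.Perm (Fin (n₁ + n₂)) =>
      (List.ofFn fun i => Fin.append (fun _ : Fin n₁ => true) (fun _ : Fin n₂ => false) (σ i)) :=
    fun _ _ => trivial
  exact hg.comp (hsort.comp happ)

instance instIsProbabilityMeasureOrderLaw (m : ℝ≥0) (p q : Measure ℝ) [IsProbabilityMeasure p]
    [IsProbabilityMeasure q] : IsProbabilityMeasure (orderLaw m p q) := by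
  have h : ∀ n₁ n₂, IsProbabilityMeasure (fixedSizeLaw p q n₁ n₂) := fun n₁ n₂ =>
    Measure.isProbabilityMeasure_map (measurable_orderPattern n₁ n₂).aemeasurable
  refine ⟨?_⟩
  rw [orderLaw, Measure.bind_apply MeasurableSet.univ (Measurable.of_discrete).aemeasurable]
  simp

instance instIsProbabilityMeasureJointLaw (m : ℝ≥0) (p q r : Measure ℝ) [IsProbabilityMeasure p]
    [IsProbabilityMeasure q] [IsProbabilityMeasure r] :
    IsProbabilityMeasure (jointLaw m p q r) := by
  refine ⟨?_⟩
  simp [jointLaw, ENNReal.inv_two_add_inv_two]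

/-! ### Order statistics of independent atomless samples. -/

section OrderStatistics

/-! Under Poissonized sampling a label word `w` has probability `exp (-2m) m ^ |w|` times an
iterated integral over ordered points (`orderLaw_singleton`, `pi_strictMono_Ioc`). By Chen's
identity (`iterInt_split`), cutting the line turns these integrals into convolutions over
concatenation of words. Two equal measures of mass `x` give `x ^ n / n!` for every word of length
`n`.

A mini-bucket is built so that its integrals agree with this value for all words of length at most
two (`IsMiniBucket.pairInt_eq`). It therefore deviates only from order three on, with size about
`(ε/k) ^ 3`, and deviations add up under concatenation (`CloseToExp.wordConv`). A group of `l`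
buckets has mass `x = l/k` and deviation `d` of order `l (ε/k) ^ 3`; as long as `m x` is bounded,
its `χ²`-divergence from the equal case is of order `d ^ 2 (m/x) ^ 3`, that is `m ^ 3 ε ^ 6 / (k ^ 3
l)` (`IsBalanced.secondMoment_le`). Large groups are better, and `l ≈ k/m` is the largest size
keeping `m x` bounded; it gives `m ^ 4 ε ^ 6 / k ^ 4` per group.

Second moments of likelihood ratios are submultiplicative under concatenation
(`secondMoment_wordConv_le`), so about `m` groups give at most `exp (C m ^ 5 ε ^ 6 / k ^ 4)`
(`secondMoment_buckets_le`). Finally the mutual information is bounded by a symmetrized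
`χ²`-divergence (`mutualInfo_mixture_le`), which is at most half the ordinary one. -/

lemma ae_injective_pi {n : ℕ} (μ : Fin n → Measure ℝ) [∀ i, IsFiniteMeasure (μ i)]
    [∀ i, NullSingletonClass (μ i)] : ∀ᵐ z ∂Measure.pi μ, Function.Injective z := by
  have key : ∀ i j : Fin n, i ≠ j → ∀ᵐ z ∂Measure.pi μ, z i ≠ z j := by
    intro i j hij
    obtain ⟨n, rfl⟩ : ∃ l, n = l + 1 := ⟨n - 1, by have := i.2; omega⟩
    obtain ⟨j', rfl⟩ := Fin.exists_succAbove_eq hij.symm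
    have hmp := measurePreserving_piFinSuccAbove μ i
    have hms : MeasurableSet {w : ℝ × (Fin n → ℝ) | w.1 = w.2 j'} :=
      measurableSet_eq_fun measurable_fst ((measurable_pi_apply j').comp measurable_snd)
    have h0 : ((μ i).prod (Measure.pi fun l => μ (i.succAbove l)))
        {w : ℝ × (Fin n → ℝ) | w.1 = w.2 j'} = 0 := by
      rw [Measure.prod_apply_symm hms]
      have : ∀ y : Fin n → ℝ, μ i ((fun x => (x, y)) ⁻¹' {w : ℝ × (Fin n → ℝ) | w.1 = w.2 j'}) = 0 :=
        fun y => measure_singleton (μ := μ i) (y j')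
      exact (lintegral_congr this).trans lintegral_zero
    rw [← hmp.measure_preimage hms.nullMeasurableSet] at h0
    rw [ae_iff]
    convert h0 using 2
    ext z
    simp only [not_not, mem_ofPred_eq, mem_preimage]
    rfl
  have : ∀ᵐ z ∂Measure.pi μ, ∀ i j : Fin n, i ≠ j → z i ≠ z j := by
    simp only [ae_all_iff]; exact key
  filter_upwards [this] with z hz i j h
  exact by_contra fun hne => hz i j hne h

lemma sort_eq_iff_strictMono {n : ℕ} {z : Fin n → ℝ} (hz : Function.Injective z)
    (σ : Equiv.Perm (Fin n)) : Tuple.sort z = σ ↔ StrictMono (z ∘ σ) := by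
  rw [eq_comm, Tuple.eq_sort_iff]
  constructor
  · exact fun h => h.1.strictMono_of_injective (hz.comp σ.injective)
  · refine fun h => ⟨h.monotone, fun i j hij he => ?_⟩
    exact absurd (σ.injective (hz he)) hij.ne

lemma measurePreserving_comp_perm {n : ℕ} (μ : Fin n → Measure ℝ) [∀ i, IsFiniteMeasure (μ i)]
    (σ : Equiv.Perm (Fin n)) :
    MeasurePreserving (fun z : Fin n → ℝ => z ∘ σ) (Measure.pi μ) (Measure.pi (μ ∘ σ)) := by
  have hm : Measurable fun z : Fin n → ℝ => z ∘ σ :=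
    measurable_pi_lambda _ fun i => measurable_pi_apply _
  have : ∀ i, IsFiniteMeasure ((μ ∘ σ) i) := fun i => inferInstanceAs (IsFiniteMeasure (μ (σ i)))
  refine ⟨hm, (Measure.pi_eq fun s hs => ?_).symm⟩
  rw [Measure.map_apply hm (MeasurableSet.univ_pi hs)]
  have : (fun z : Fin n → ℝ => z ∘ σ) ⁻¹' pi univ s = pi univ fun i => s (σ.symm i) := by
    ext z
    simp only [mem_preimage, mem_univ_pi, Function.comp]
    exact ⟨fun h i => by simpa using h (σ.symm i), fun h i => by simpa using h (σ i)⟩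
  rw [this, Measure.pi_pi, ← Equiv.prod_comp σ]
  simp

lemma measurableSet_strictMono (n : ℕ) : MeasurableSet {z : Fin n → ℝ | StrictMono z} := by
  have : {z : Fin n → ℝ | StrictMono z} =
      ⋂ i : Fin n, ⋂ j : Fin n, ⋂ _ : i < j, {z : Fin n → ℝ | z i < z j} := by
    ext z; simp [StrictMono]
  rw [this]
  exact .iInter fun i => .iInter fun j => .iInter fun _ =>
    measurableSet_lt (measurable_pi_apply _) (measurable_pi_apply _)

/-- Ties are null, so the tie-breaking rule of `Tuple.sort` is irrelevant, and relabelling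
coordinates by `σ` reduces every ordering to the increasing one. -/
lemma pi_sort_eq {n : ℕ} (μ : Fin n → Measure ℝ) [∀ i, IsFiniteMeasure (μ i)]
    [∀ i, NullSingletonClass (μ i)] (σ : Equiv.Perm (Fin n)) :
    Measure.pi μ {z | Tuple.sort z = σ} = Measure.pi (μ ∘ σ) {z | StrictMono z} := by
  rw [← (measurePreserving_comp_perm μ σ).measure_preimage
    (measurableSet_strictMono n).nullMeasurableSet]
  refine measure_congr ?_
  filter_upwards [ae_injective_pi μ] with z hz
  exact propext (sort_eq_iff_strictMono hz σ)

/-- By symmetry, independent samples from one atomless measure are equally likely to arrive in any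
order. -/
lemma pi_const_strictMono (n : ℕ) (μ : Measure ℝ) [IsFiniteMeasure μ] [NullSingletonClass μ] :
    Measure.pi (fun _ : Fin n => μ) {z | StrictMono z} * (n.factorial : ℝ≥0∞) = μ univ ^ n := by
  have h1 : ∑ σ : Equiv.Perm (Fin n), Measure.pi (fun _ : Fin n => μ) {z | Tuple.sort z = σ} =
      Measure.pi (fun _ : Fin n => μ) univ := by
    rw [← measure_biUnion_finset]
    · congr 1; ext z; simp
    · intro σ _ τ _ hne
      exact disjoint_left.2 fun z hz hz' => hne (hz.symm.trans hz')
    · exact fun σ _ => measurableSet_sort_eq σ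
  rw [Measure.pi_univ] at h1
  simp only [pi_sort_eq] at h1
  have h2 : ∀ σ : Equiv.Perm (Fin n), (fun _ : Fin n => μ) ∘ σ = fun _ => μ := fun _ => rfl
  simp only [h2, Finset.sum_const, Finset.card_univ, Fintype.card_perm, Fintype.card_fin,
    nsmul_eq_mul, Finset.prod_const] at h1
  rw [mul_comm, h1]

lemma measurePreserving_append (n₁ n₂ : ℕ) (p q : Measure ℝ) [IsFiniteMeasure p]
    [IsFiniteMeasure q] :
    MeasurePreserving (fun z : (Fin n₁ → ℝ) × (Fin n₂ → ℝ) => Fin.append z.1 z.2)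
      ((Measure.pi fun _ : Fin n₁ => p).prod (Measure.pi fun _ : Fin n₂ => q))
      (Measure.pi (Fin.append (fun _ : Fin n₁ => p) (fun _ : Fin n₂ => q))) := by
  have hm : Measurable fun z : (Fin n₁ → ℝ) × (Fin n₂ → ℝ) => Fin.append z.1 z.2 := by
    refine measurable_pi_lambda _ fun i => ?_
    induction i using Fin.addCases with
    | left i => simp only [Fin.append_left]; fun_prop
    | right i => simp only [Fin.append_right]; fun_prop
  have : ∀ i, IsFiniteMeasure (Fin.append (fun _ : Fin n₁ => p) (fun _ : Fin n₂ => q) i) := by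
    intro i
    induction i using Fin.addCases with
    | left i => simp only [Fin.append_left]; infer_instance
    | right i => simp only [Fin.append_right]; infer_instance
  refine ⟨hm, (Measure.pi_eq fun s hs => ?_).symm⟩
  rw [Measure.map_apply hm (MeasurableSet.univ_pi hs)]
  have : (fun z : (Fin n₁ → ℝ) × (Fin n₂ → ℝ) => Fin.append z.1 z.2) ⁻¹' pi univ s =
      (pi univ fun i => s (Fin.castAdd n₂ i)) ×ˢ (pi univ fun i => s (Fin.natAdd n₁ i)) := by
    ext z
    simp only [mem_preimage, mem_univ_pi, mem_prod]
    constructor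
    · exact fun h => ⟨fun i => by simpa using h (Fin.castAdd n₂ i),
        fun i => by simpa using h (Fin.natAdd n₁ i)⟩
    · rintro ⟨h1, h2⟩ i
      induction i using Fin.addCases with
      | left i => simpa using h1 i
      | right i => simpa using h2 i
  rw [this, Measure.prod_prod, Measure.pi_pi, Measure.pi_pi, Fin.prod_univ_add]
  simp

end OrderStatistics

/-! ### From orderings of samples to probabilities of label words. -/

section Labels

/-- The family of measures indexed by labels: `true` for `p`, `false` for `q`. -/
noncomputable def labelMeasure (p q : Measure ℝ) (b : Bool) : Measure ℝ := if b then p else q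

instance (p q : Measure ℝ) [IsFiniteMeasure p] [IsFiniteMeasure q] (b : Bool) :
    IsFiniteMeasure (labelMeasure p q b) := by
  cases b <;> simpa [labelMeasure]

instance (p q : Measure ℝ) [NullSingletonClass p] [NullSingletonClass q] (b : Bool) :
    NullSingletonClass (labelMeasure p q b) := by
  cases b <;> simpa [labelMeasure]

lemma count_true_ofFn {n : ℕ} (f : Fin n → Bool) :
    (List.ofFn f).count true = Fintype.card {i // f i = true} := by
  rw [Fintype.card_subtype, Finset.card_filter]
  induction n with
  | zero => simp
  | succ n ih => rw [List.ofFn_succ, List.count_cons, ih, Fin.sum_univ_succ, add_comm]; simp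

/-- The number of ways to order `n₁` samples labelled `true` and `n₂` samples labelled `false` into
a given sequence of labels. -/
lemma card_perm_comp_eq {n₁ n₂ : ℕ} (w : Fin (n₁ + n₂) → Bool)
    (h : (List.ofFn w).count true = n₁) :
    (Finset.univ.filter fun σ : Equiv.Perm (Fin (n₁ + n₂)) =>
      Fin.append (fun _ : Fin n₁ => true) (fun _ : Fin n₂ => false) ∘ σ = w).card =
      n₁.factorial * n₂.factorial := by
  set l : Fin (n₁ + n₂) → Bool := Fin.append (fun _ : Fin n₁ => true) (fun _ : Fin n₂ => false)
  have cl : ∀ f : Fin (n₁ + n₂) → Bool, (List.ofFn f).count true = Fintype.card {i // f i = true} :=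
    fun f => count_true_ofFn f
  have cl1 : Fintype.card {i // l i = true} = n₁ := by
    rw [← cl, List.ofFn_fin_append]; simp [List.count_replicate]
  have cf : ∀ f : Fin (n₁ + n₂) → Bool, Fintype.card {i // f i = true} = n₁ →
      Fintype.card {i // f i = false} = n₂ := by
    intro f hf
    have := Fintype.card_subtype_compl (fun i => f i = true)
    simp only [Bool.not_eq_true, Fintype.card_fin] at this
    omega
  rw [cl] at h
  obtain ⟨e⟩ : Nonempty ({i // w i = true} ≃ {i // l i = true}) :=
    ⟨Fintype.equivOfCardEq (h.trans cl1.symm)⟩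
  obtain ⟨e'⟩ : Nonempty ({i // ¬ w i = true} ≃ {i // ¬ l i = true}) :=
    ⟨Fintype.equivOfCardEq (by simp only [Bool.not_eq_true]; rw [cf w h, cf l cl1])⟩
  obtain ⟨σ₀, hσ₀⟩ : ∃ σ₀ : Equiv.Perm (Fin (n₁ + n₂)), l ∘ σ₀ = w := by
    refine ⟨(Equiv.sumCompl _).symm.trans ((Equiv.sumCongr e e').trans (Equiv.sumCompl _)), ?_⟩
    ext i
    by_cases hi : w i = true
    · simp [Equiv.sumCompl_symm_apply_of_pos (p := fun i => w i = true) hi, hi, (e ⟨i, hi⟩).2]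
    · have h2 := (e' ⟨i, hi⟩).2
      simp only [Bool.not_eq_true] at hi h2
      simp [Equiv.sumCompl_symm_apply_of_neg (p := fun i => w i = true) (by simpa using hi), hi, h2]
  -- The solutions of `l ∘ σ = w` form a coset, through `σ₀`, of the stabilizer of `l`, which has
  -- order `n₁! n₂!`.
  have hst := DomMulAct.stabilizer_card l
  rw [Fintype.prod_bool, cl1, cf l cl1] at hst
  rw [← hst, Fintype.card_subtype]
  refine Finset.card_bij' (fun σ _ => σ * σ₀⁻¹) (fun g _ => g * σ₀) ?_ ?_ ?_ ?_
  · intro σ hσ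
    simp only [Finset.mem_filter, Finset.mem_univ, true_and] at hσ ⊢
    ext i
    simp only [Function.comp, Equiv.Perm.coe_mul]
    have h1 := congrFun hσ (σ₀⁻¹ i)
    have h2 := congrFun hσ₀ (σ₀⁻¹ i)
    simp only [Function.comp, ← Equiv.Perm.mul_apply, mul_inv_cancel, Equiv.Perm.one_apply] at h1 h2
    simpa using h1.trans h2.symm
  · intro g hg
    simp only [Finset.mem_filter, Finset.mem_univ, true_and] at hg ⊢
    rw [Equiv.Perm.coe_mul, ← Function.comp_assoc, hg, hσ₀]
  · intro σ _; simp
  · intro g _; simp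

/-- All orderings that produce `w` are equally likely. The factor `n₁! n₂!` later cancels the
factorials of the two Poisson weights. -/
lemma fixedSizeLaw_singleton_of_count_eq {n₁ n₂ : ℕ} (p q : Measure ℝ) [IsFiniteMeasure p]
    [IsFiniteMeasure q] [NullSingletonClass p] [NullSingletonClass q] (w : Fin (n₁ + n₂) → Bool)
    (h : (List.ofFn w).count true = n₁) :
    fixedSizeLaw p q n₁ n₂ {List.ofFn w} = (n₁.factorial * n₂.factorial : ℕ) *
      Measure.pi (fun i => labelMeasure p q (w i)) {z | StrictMono z} := by
  set l : Fin (n₁ + n₂) → Bool := Fin.append (fun _ : Fin n₁ => true) (fun _ : Fin n₂ => false)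
    with hl
  have hμ : (fun i => labelMeasure p q (l i)) =
      Fin.append (fun _ : Fin n₁ => p) (fun _ : Fin n₂ => q) := by
    ext1 i
    induction i using Fin.addCases with
    | left i => simp [hl, labelMeasure]
    | right i => simp [hl, labelMeasure]
  have hset : (fun z : (Fin n₁ → ℝ) × (Fin n₂ → ℝ) => orderPattern z.1 z.2) ⁻¹' {List.ofFn w} =
      (fun z : (Fin n₁ → ℝ) × (Fin n₂ → ℝ) => Fin.append z.1 z.2) ⁻¹'
        ⋃ σ ∈ Finset.univ.filter (fun σ : Equiv.Perm (Fin (n₁ + n₂)) => l ∘ σ = w),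
          {z | Tuple.sort z = σ} := by
    ext z
    simp only [mem_preimage, mem_singleton_iff, orderPattern, List.ofFn_inj, mem_iUnion,
      Finset.mem_filter, Finset.mem_univ, true_and, mem_ofPred_eq, exists_prop]
    exact ⟨fun h => ⟨_, h, rfl⟩, fun ⟨_, h, h'⟩ => h' ▸ h⟩
  rw [fixedSizeLaw, Measure.map_apply (measurable_orderPattern n₁ n₂) (measurableSet_singleton _),
    hset, (measurePreserving_append n₁ n₂ p q).measure_preimage
      (Finset.measurableSet_biUnion _ fun σ _ => measurableSet_sort_eq σ).nullMeasurableSet, ← hμ,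
    measure_biUnion_finset, Finset.sum_congr rfl (g := fun _ =>
      Measure.pi (fun i => labelMeasure p q (w i)) {z | StrictMono z}), Finset.sum_const,
    card_perm_comp_eq w h, nsmul_eq_mul]
  · intro σ hσ
    rw [pi_sort_eq]
    simp only [Finset.mem_filter, Finset.mem_univ, true_and] at hσ
    rw [← hσ]
    rfl
  · intro σ _ τ _ hne
    exact disjoint_left.2 fun z hz hz' => hne (hz.symm.trans hz')
  · exact fun σ _ => measurableSet_sort_eq σ

lemma count_orderPattern {n₁ n₂ : ℕ} (x : Fin n₁ → ℝ) (y : Fin n₂ → ℝ) :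
    (orderPattern x y).count true = n₁ ∧ (orderPattern x y).count false = n₂ := by
  have := Equiv.Perm.ofFn_comp_perm (Tuple.sort (Fin.append x y))
    (Fin.append (fun _ : Fin n₁ => true) (fun _ : Fin n₂ => false))
  have h2 : (orderPattern x y).Perm
      (List.ofFn (Fin.append (fun _ : Fin n₁ => true) (fun _ : Fin n₂ => false))) := this
  rw [h2.count_eq, h2.count_eq, List.ofFn_fin_append]
  simp [List.count_replicate]

/-- The probability of a label sequence under Poissonized sampling. -/
lemma orderLaw_singleton (m : ℝ≥0) (p q : Measure ℝ) [IsProbabilityMeasure p]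
    [IsProbabilityMeasure q] [NullSingletonClass p] [NullSingletonClass q] (w : List Bool) :
    orderLaw m p q {w} = ENNReal.ofReal (Real.exp (-(2 * m)) * m ^ w.length) *
      Measure.pi (fun i : Fin w.length => labelMeasure p q (w.get i)) {z | StrictMono z} := by
  rw [orderLaw, Measure.bind_apply (measurableSet_singleton _)
    (Measurable.of_discrete).aemeasurable]
  set n₁ := w.count true with hn₁
  set n₂ := w.count false with hn₂
  have hlen : w.length = n₁ + n₂ := by
    rw [hn₁, hn₂]; exact (List.count_true_add_count_false _).symm
  -- The word determines both sample sizes, so a single pair of sizes contributes to the mixture.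
  have h0 : ∀ n : ℕ × ℕ, fixedSizeLaw p q n.1 n.2 {w} =
      ({(n₁, n₂)} : Set (ℕ × ℕ)).indicator (fun _ => fixedSizeLaw p q n₁ n₂ {w}) n := by
    intro n
    by_cases hn : n = (n₁, n₂)
    · subst hn; simp
    · rw [indicator_of_notMem (by simpa using hn), fixedSizeLaw,
        Measure.map_apply (measurable_orderPattern _ _) (measurableSet_singleton _)]
      convert measure_empty
      · ext z
        simp only [mem_preimage, mem_singleton_iff, mem_empty_iff_false, iff_false]
        intro hz
        have := count_orderPattern z.1 z.2
        rw [hz] at this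
        exact hn (Prod.ext this.1.symm this.2.symm)
      · infer_instance
  simp_rw [h0]
  rw [lintegral_indicator (measurableSet_singleton _), setLIntegral_const,
    ← singleton_prod_singleton, Measure.prod_prod, poissonMeasure_singleton,
    poissonMeasure_singleton]
  obtain ⟨w', hw'⟩ : ∃ w' : Fin (n₁ + n₂) → Bool, w = List.ofFn w' :=
    ⟨fun i => w.get (i.cast hlen.symm), by
      apply List.ext_get <;> simp [hlen]⟩
  clear_value n₁ n₂
  subst hw'
  rw [fixedSizeLaw_singleton_of_count_eq p q w' hn₁.symm]
  have hpi : ∀ {a : ℕ} (ha : a = n₁ + n₂) (v : Fin a → Bool),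
      (∀ i, v i = w' (i.cast ha)) →
      Measure.pi (fun i => labelMeasure p q (v i)) {z | StrictMono z} =
      Measure.pi (fun i => labelMeasure p q (w' i)) {z | StrictMono z} := by
    intro a ha v hv
    subst ha
    congr; ext1 i; rw [hv]; rfl
  rw [hpi hlen _ (by intro i; simp; rfl), hlen, ← ENNReal.ofReal_mul (by positivity)]
  rw [mul_comm _ (Measure.pi _ _), mul_assoc, mul_comm]
  congr 1
  rw [← ENNReal.ofReal_natCast, ← ENNReal.ofReal_mul (by positivity)]
  congr 1
  push_cast
  have : Real.exp (-(2 * (m : ℝ))) = Real.exp (-m) * Real.exp (-m) := by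
    rw [← Real.exp_add]; ring_nf
  rw [this, pow_add]
  field_simp

end Labels

/-! ### Iterated integrals indexed by words. -/

section IteratedIntegrals

/-- The iterated integral `∫_{s < x₁ < ⋯ < xₙ ≤ t} dν_{w₁}(x₁) ⋯ dν_{wₙ}(xₙ)`. -/
noncomputable def iterInt (ν : Bool → Measure ℝ) (t : ℝ) : List Bool → ℝ → ℝ≥0∞
  | [], _ => 1
  | b :: w, s => ∫⁻ x in Ioc s t, iterInt ν t w x ∂ν b

variable {ν ν' : Bool → Measure ℝ} {s c t : ℝ}

lemma iterInt_antitone (w : List Bool) : Antitone (iterInt ν t w) := by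
  cases w with
  | nil => exact fun _ _ _ => le_rfl
  | cons b w => exact fun x y h => lintegral_mono_set (Ioc_subset_Ioc_left h)

lemma measurable_iterInt (w : List Bool) : Measurable (iterInt ν t w) :=
  (iterInt_antitone w).measurable

lemma iterInt_mono_measure (h : ∀ b, ν b ≤ ν' b) (w : List Bool) (s : ℝ) :
    iterInt ν t w s ≤ iterInt ν' t w s := by
  induction w generalizing s with
  | nil => exact le_rfl
  | cons b w ih =>
    exact lintegral_mono' (Measure.restrict_mono le_rfl (h b)) fun x => ih x

lemma iterInt_congr (w : List Bool)
    (h : ∀ b ∈ w, (ν b).restrict (Ioc s t) = (ν' b).restrict (Ioc s t)) :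
    iterInt ν t w s = iterInt ν' t w s := by
  induction w generalizing s with
  | nil => rfl
  | cons b w ih =>
    simp only [iterInt]
    rw [h b (by simp)]
    refine setLIntegral_congr_fun measurableSet_Ioc fun x hx => ih fun b' hb' => ?_
    have hsub : Ioc x t ⊆ Ioc s t := Ioc_subset_Ioc_left hx.1.le
    rw [← Measure.restrict_restrict_of_subset hsub, h b' (by simp [hb']),
      Measure.restrict_restrict_of_subset hsub]

/-- Splitting the range of integration (Chen's identity). -/
lemma iterInt_split (hsc : s ≤ c) (hct : c ≤ t) (w : List Bool) :
    iterInt ν t w s = ∑ i ∈ Finset.range (w.length + 1),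
      iterInt ν c (w.take i) s * iterInt ν t (w.drop i) c := by
  induction w generalizing s with
  | nil => simp [iterInt]
  | cons b w ih =>
    -- The term `i = 0` is split off: there the first, hence every, variable lies beyond `c`.
    rw [List.length_cons, Finset.sum_range_succ']
    simp only [List.take_succ_cons, List.drop_succ_cons, List.take_zero, List.drop_zero]
    simp only [iterInt, one_mul]
    rw [← Ioc_union_Ioc_eq_Ioc hsc hct, lintegral_union measurableSet_Ioc
      (Ioc_disjoint_Ioc_of_le le_rfl)]
    congr 1
    simp_rw [← lintegral_mul_const _ (measurable_iterInt _)]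
    rw [← lintegral_finsetSum _ fun i _ => (measurable_iterInt _).mul_const _]
    exact setLIntegral_congr_fun measurableSet_Ioc fun x hx => ih hx.2

lemma iterInt_singleton (b : Bool) : iterInt ν t [b] s = ν b (Ioc s t) := by
  simp [iterInt]

lemma iterInt_pair_le (b b' : Bool) :
    iterInt ν t [b, b'] s ≤ ν b (Ioc s t) * ν b' (Ioc s t) := by
  have : iterInt ν t [b, b'] s ≤ ∫⁻ _ in Ioc s t, ν b' (Ioc s t) ∂ν b := by
    refine setLIntegral_mono' measurableSet_Ioc fun x hx => ?_
    rw [iterInt_singleton]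
    exact measure_mono (Ioc_subset_Ioc_left hx.1.le)
  simpa [mul_comm] using this

lemma strictMono_Ioc_succ {n : ℕ} (z : Fin (n + 1) → ℝ) :
    (StrictMono z ∧ ∀ i, z i ∈ Ioc s t) ↔
      z 0 ∈ Ioc s t ∧ StrictMono (fun i : Fin n => z i.succ) ∧ ∀ i : Fin n, z i.succ ∈ Ioc (z 0) t := by
  constructor
  · rintro ⟨h1, h2⟩
    exact ⟨h2 0, fun i j h => h1 (Fin.succ_lt_succ_iff.2 h),
      fun i => ⟨h1 (Fin.succ_pos i), (h2 _).2⟩⟩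
  · rintro ⟨h0, h1, h2⟩
    refine ⟨?_, fun i => ?_⟩
    · intro i j hij
      cases j using Fin.cases with
      | zero => exact absurd hij (Fin.not_lt_zero i)
      | succ j =>
        cases i using Fin.cases with
        | zero => exact (h2 j).1
        | succ i => exact h1 (Fin.succ_lt_succ_iff.1 hij)
    · cases i using Fin.cases with
      | zero => exact h0
      | succ i => exact ⟨h0.1.trans (h2 i).1, (h2 i).2⟩

/-- Fubini in the smallest coordinate reproduces the recursion of `iterInt`. -/
lemma pi_strictMono_Ioc [∀ b, IsFiniteMeasure (ν b)] (w : List Bool) (s : ℝ) :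
    Measure.pi (fun i : Fin w.length => ν (w.get i)) {z | StrictMono z ∧ ∀ i, z i ∈ Ioc s t} =
      iterInt ν t w s := by
  induction w generalizing s with
  | nil =>
    have : {z : Fin ([] : List Bool).length → ℝ | StrictMono z ∧ ∀ i, z i ∈ Ioc s t} = univ := by
      ext z
      simp only [mem_ofPred_eq, mem_univ, iff_true]
      exact ⟨fun i => i.elim0, fun i => i.elim0⟩
    rw [this, Measure.pi_univ]
    simp [iterInt]
  | cons b w ih =>
    have hmp := (measurePreserving_piFinSuccAbove
      (fun i : Fin (w.length + 1) => ν ((b :: w).get i)) 0)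
    have hms : MeasurableSet {x : ℝ × (Fin w.length → ℝ) | x.1 ∈ Ioc s t ∧
        StrictMono x.2 ∧ ∀ i, x.2 i ∈ Ioc x.1 t} := by
      refine (measurable_fst measurableSet_Ioc).inter
        ((measurable_snd (measurableSet_strictMono _)).inter ?_)
      have : {x : ℝ × (Fin w.length → ℝ) | ∀ i, x.2 i ∈ Ioc x.1 t} =
          ⋂ i, ({x : ℝ × (Fin w.length → ℝ) | x.1 < x.2 i} ∩ {x | x.2 i ≤ t}) := by
        ext x; simp
      change MeasurableSet {x : ℝ × (Fin w.length → ℝ) | ∀ i, x.2 i ∈ Ioc x.1 t}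
      rw [this]
      exact .iInter fun i => (measurableSet_lt (by fun_prop) (by fun_prop)).inter
        (measurableSet_le (by fun_prop) (by fun_prop))
    have hset : {z : Fin (b :: w).length → ℝ | StrictMono z ∧ ∀ i, z i ∈ Ioc s t} =
        MeasurableEquiv.piFinSuccAbove (fun _ : Fin (w.length + 1) => ℝ) 0 ⁻¹'
          {x : ℝ × (Fin w.length → ℝ) | x.1 ∈ Ioc s t ∧
            StrictMono x.2 ∧ ∀ i, x.2 i ∈ Ioc x.1 t} := by
      ext z
      exact strictMono_Ioc_succ (n := w.length) z
    rw [hset]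
    refine (hmp.measure_preimage hms.nullMeasurableSet).trans ?_
    rw [Measure.prod_apply hms, iterInt, ← lintegral_indicator measurableSet_Ioc]
    refine lintegral_congr fun x => ?_
    by_cases hx : x ∈ Ioc s t
    · rw [indicator_of_mem hx, ← ih]
      change Measure.pi (fun i : Fin w.length => ν (w.get i)) {y | x ∈ Ioc s t ∧ StrictMono y ∧
        ∀ i, y i ∈ Ioc x t} = _
      simp only [hx, true_and]
    · rw [indicator_of_notMem hx]
      change Measure.pi (fun i : Fin w.length => ν (w.get i)) {y | x ∈ Ioc s t ∧ StrictMono y ∧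
        ∀ i, y i ∈ Ioc x t} = _
      simp only [hx, false_and]
      exact measure_empty

lemma pi_const_strictMono_Ioc (n : ℕ) (μ : Measure ℝ) [IsFiniteMeasure μ] [NullSingletonClass μ] :
    Measure.pi (fun _ : Fin n => μ) {z | StrictMono z ∧ ∀ i, z i ∈ Ioc s t} * n.factorial =
      μ (Ioc s t) ^ n := by
  have h := pi_const_strictMono n (μ.restrict (Ioc s t))
  rw [← Measure.restrict_pi_pi, Measure.restrict_apply (measurableSet_strictMono n)] at h
  simp only [Measure.restrict_apply_univ] at h
  rw [← h]
  congr 2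
  ext z; simp

lemma iterInt_const (μ : Measure ℝ) [IsFiniteMeasure μ] [NullSingletonClass μ] (w : List Bool) :
    iterInt (fun _ => μ) t w s * w.length.factorial = μ (Ioc s t) ^ w.length := by
  rw [← pi_strictMono_Ioc, pi_const_strictMono_Ioc]

/-- Summing over all words of a given length forgets the labels. -/
lemma sum_iterInt_ofFn (n : ℕ) (s : ℝ) :
    ∑ f : Fin n → Bool, iterInt ν t (List.ofFn f) s =
      iterInt (fun _ => ν true + ν false) t (List.replicate n true) s := by
  induction n generalizing s with
  | zero => simp [iterInt]
  | succ n ih =>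
    rw [← (Fin.consEquiv fun _ => Bool).sum_comp, Fintype.sum_prod_type]
    simp only [Fin.consEquiv, Equiv.coe_fn_mk, List.ofFn_cons, Fintype.sum_bool,
      List.replicate_succ, iterInt]
    simp_rw [← lintegral_finsetSum _ fun f _ => measurable_iterInt _, ih]
    rw [Measure.restrict_add, lintegral_add_measure]

end IteratedIntegrals

/-! ### Coefficients of exponential series. -/

section ExponentialSeries

/-- The coefficients of `exp (x X)`. -/
noncomputable def expCoeff (x : ℝ) (n : ℕ) : ℝ := x ^ n / n.factorial

/-- The coefficients of `X ^ 3 * exp (x X)`. -/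
noncomputable def shiftExpCoeff (x : ℝ) (n : ℕ) : ℝ := if n < 3 then 0 else expCoeff x (n - 3)

lemma expCoeff_nonneg {x : ℝ} (hx : 0 ≤ x) (n : ℕ) : 0 ≤ expCoeff x n := by
  unfold expCoeff; positivity

lemma shiftExpCoeff_nonneg {x : ℝ} (hx : 0 ≤ x) (n : ℕ) : 0 ≤ shiftExpCoeff x n := by
  unfold shiftExpCoeff; split_ifs
  exacts [le_rfl, expCoeff_nonneg hx _]

lemma expCoeff_mono {x y : ℝ} (hx : 0 ≤ x) (hxy : x ≤ y) (n : ℕ) : expCoeff x n ≤ expCoeff y n := by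
  unfold expCoeff; gcongr

lemma expCoeff_conv (x y : ℝ) (n : ℕ) :
    ∑ i ∈ Finset.range (n + 1), expCoeff x i * expCoeff y (n - i) = expCoeff (x + y) n := by
  rw [expCoeff, add_pow, Finset.sum_div]
  refine Finset.sum_congr rfl fun i hi => ?_
  have hi' : i ≤ n := Nat.lt_succ_iff.1 (Finset.mem_range.1 hi)
  rw [expCoeff, expCoeff, Nat.cast_choose ℝ hi']
  field_simp

lemma shiftExpCoeff_conv_expCoeff (x y : ℝ) (n : ℕ) :
    ∑ i ∈ Finset.range (n + 1), shiftExpCoeff x i * expCoeff y (n - i) =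
      shiftExpCoeff (x + y) n := by
  by_cases hn : n < 3
  · rw [shiftExpCoeff, if_pos hn]
    refine Finset.sum_eq_zero fun i hi => ?_
    rw [shiftExpCoeff, if_pos (by have := Finset.mem_range.1 hi; omega), zero_mul]
  · obtain ⟨l, rfl⟩ : ∃ l, n = l + 3 := ⟨n - 3, by omega⟩
    rw [Finset.sum_range_succ', Finset.sum_range_succ', Finset.sum_range_succ']
    simp only [shiftExpCoeff]
    norm_num
    rw [← expCoeff_conv]
    refine Finset.sum_congr rfl fun i _ => ?_
    rw [if_neg (by omega), show i + 1 + 1 + 1 - 3 = i by omega,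
      show l + 3 - (i + 1 + 1 + 1) = l - i by omega]

lemma expCoeff_conv_shiftExpCoeff (x y : ℝ) (n : ℕ) :
    ∑ i ∈ Finset.range (n + 1), expCoeff x i * shiftExpCoeff y (n - i) =
      shiftExpCoeff (x + y) n := by
  rw [← Finset.sum_range_reflect, add_comm x, ← shiftExpCoeff_conv_expCoeff]
  refine Finset.sum_congr rfl fun i hi => ?_
  have : i ≤ n := Nat.lt_succ_iff.1 (Finset.mem_range.1 hi)
  rw [mul_comm]
  congr 2
  omega

end ExponentialSeries

/-! ### Convolution on words and stability of closeness to the exponential. -/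

section WordFunctions

/-- The convolution of two functions on words, with respect to concatenation. -/
noncomputable def wordConv (f g : List Bool → ℝ) (w : List Bool) : ℝ :=
  ∑ i ∈ Finset.range (w.length + 1), f (w.take i) * g (w.drop i)

lemma sum_take_drop (φ ψ : ℕ → ℝ) (w : List Bool) :
    ∑ i ∈ Finset.range (w.length + 1), φ (w.take i).length * ψ (w.drop i).length =
      ∑ i ∈ Finset.range (w.length + 1), φ i * ψ (w.length - i) := by
  refine Finset.sum_congr rfl fun i hi => ?_
  have : i ≤ w.length := Nat.lt_succ_iff.1 (Finset.mem_range.1 hi)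
  rw [List.length_take, List.length_drop, min_eq_left this]

lemma wordConv_expCoeff (x y : ℝ) (w : List Bool) :
    wordConv (fun u => expCoeff x u.length) (fun u => expCoeff y u.length) w =
      expCoeff (x + y) w.length := by
  rw [wordConv, sum_take_drop (expCoeff x) (expCoeff y), expCoeff_conv]

/-- `f` agrees with `exp (x X)` up to `d X ^ 3 exp (2 x X)`. -/
def CloseToExp (f : List Bool → ℝ) (x d : ℝ) : Prop :=
  ∀ w, |f w - expCoeff x w.length| ≤ d * shiftExpCoeff (2 * x) w.length

/-- Write `fg - exp exp = (f - exp) g + exp (g - exp)`. The doubled rate in the error term absorbs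
the factor `g`, bounded only at rate `2 * y`, so the errors add with no loss of constants. -/
lemma CloseToExp.wordConv {f g : List Bool → ℝ} {x y d e : ℝ} (hx : 0 ≤ x) (hd : 0 ≤ d)
    (hf : CloseToExp f x d) (hg : CloseToExp g y e) (hg0 : ∀ w, 0 ≤ g w)
    (hg1 : ∀ w, g w ≤ expCoeff (2 * y) w.length) :
    CloseToExp (wordConv f g) (x + y) (d + e) := by
  intro w
  have hsplit : _root_.wordConv f g w - expCoeff (x + y) w.length =
      ∑ i ∈ Finset.range (w.length + 1),
        ((f (w.take i) - expCoeff x (w.take i).length) * g (w.drop i) +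
          expCoeff x (w.take i).length * (g (w.drop i) - expCoeff y (w.drop i).length)) := by
    rw [← wordConv_expCoeff, _root_.wordConv, _root_.wordConv, ← Finset.sum_sub_distrib]
    exact Finset.sum_congr rfl fun i _ => by ring
  rw [hsplit]
  calc _ ≤ ∑ i ∈ Finset.range (w.length + 1),
        (d * (shiftExpCoeff (2 * x) (w.take i).length * expCoeff (2 * y) (w.drop i).length) +
          e * (expCoeff (2 * x) (w.take i).length * shiftExpCoeff (2 * y) (w.drop i).length)) := by
        refine (Finset.abs_sum_le_sum_abs _ _).trans (Finset.sum_le_sum fun i _ => ?_)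
        refine (abs_add_le _ _).trans (add_le_add ?_ ?_)
        · rw [abs_mul, abs_of_nonneg (hg0 _), ← mul_assoc]
          exact mul_le_mul (hf _) (hg1 _) (hg0 _)
            (mul_nonneg hd (shiftExpCoeff_nonneg (by positivity) _))
        · rw [abs_mul, abs_of_nonneg (expCoeff_nonneg hx _), mul_left_comm]
          exact mul_le_mul (expCoeff_mono hx (by linarith) _) (hg _) (abs_nonneg _)
            (expCoeff_nonneg (by positivity) _)
    _ = _ := by
        rw [Finset.sum_add_distrib, ← Finset.mul_sum, ← Finset.mul_sum,
          sum_take_drop (shiftExpCoeff (2 * x)) (expCoeff (2 * y)),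
          sum_take_drop (expCoeff (2 * x)) (shiftExpCoeff (2 * y)),
          shiftExpCoeff_conv_expCoeff, expCoeff_conv_shiftExpCoeff, mul_add, add_mul]

end WordFunctions

/-! ### Moment matching in buckets and accumulation of errors. -/

section Buckets

variable {p q : Measure ℝ} {s c t : ℝ}

/-- The iterated integral over `(s, t]` for the two labelled measures, as a real number. -/
noncomputable def pairInt (p q : Measure ℝ) (s t : ℝ) (w : List Bool) : ℝ :=
  (iterInt (labelMeasure p q) t w s).toReal

lemma pairInt_nonneg (w : List Bool) : 0 ≤ pairInt p q s t w := ENNReal.toReal_nonneg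

lemma pairInt_singleton (b : Bool) :
    pairInt p q s t [b] = (labelMeasure p q b).real (Ioc s t) := by
  rw [pairInt, iterInt_singleton]; rfl

lemma pairInt_pair_eq_zero {b b' : Bool} (h : labelMeasure p q b (Ioc s t) = 0 ∨
    labelMeasure p q b' (Ioc s t) = 0) : pairInt p q s t [b, b'] = 0 := by
  have := iterInt_pair_le (ν := labelMeasure p q) (s := s) (t := t) b b'
  rw [mul_eq_zero.2 h, nonpos_iff_eq_zero] at this
  rw [pairInt, this, ENNReal.toReal_zero]

lemma iterInt_const_eq (μ : Measure ℝ) [IsFiniteMeasure μ] [NullSingletonClass μ] (w : List Bool) :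
    iterInt (fun _ => μ) t w s = ENNReal.ofReal (expCoeff (μ.real (Ioc s t)) w.length) := by
  have h := iterInt_const (s := s) (t := t) μ w
  have hf : (w.length.factorial : ℝ≥0∞) ≠ 0 := by exact_mod_cast w.length.factorial_ne_zero
  rw [expCoeff, ENNReal.ofReal_div_of_pos (by positivity), ENNReal.ofReal_natCast,
    ENNReal.ofReal_pow measureReal_nonneg, ofReal_measureReal, ← h]
  exact (ENNReal.mul_div_cancel_right hf (ENNReal.natCast_ne_top _)).symm

lemma pairInt_eq_of_restrict_eq [IsFiniteMeasure p] [NullSingletonClass p]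
    (h : p.restrict (Ioc s t) = q.restrict (Ioc s t)) (w : List Bool) :
    pairInt p q s t w = expCoeff (p.real (Ioc s t)) w.length := by
  rw [pairInt, iterInt_congr (ν' := fun _ => p), iterInt_const_eq,
    ENNReal.toReal_ofReal (expCoeff_nonneg measureReal_nonneg _)]
  intro b _
  cases b <;> simp [labelMeasure, h]

/-- An interval on which both measures have mass `x` and the label sequence is nearly uniform. -/
structure IsBalanced (p q : Measure ℝ) (s t x d : ℝ) : Prop where
  le : s ≤ t
  mass_left : p.real (Ioc s t) = x
  mass_right : q.real (Ioc s t) = x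
  close : CloseToExp (pairInt p q s t) x d

lemma IsBalanced.nonneg {x d : ℝ} (h : IsBalanced p q s t x d) : 0 ≤ x :=
  h.mass_left ▸ measureReal_nonneg

variable [IsFiniteMeasure p] [IsFiniteMeasure q] [NullSingletonClass p] [NullSingletonClass q]

instance : NullSingletonClass (p + q) := ⟨fun x => by simp⟩

/-- Both measures are dominated by `p + q`, for which the labels no longer matter. -/
lemma iterInt_labelMeasure_le (w : List Bool) : iterInt (labelMeasure p q) t w s ≤
    ENNReal.ofReal (expCoeff (p.real (Ioc s t) + q.real (Ioc s t)) w.length) := by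
  rw [← measureReal_add_apply, ← iterInt_const_eq]
  refine iterInt_mono_measure (fun b => ?_) w s
  cases b
  · exact Measure.le_add_left le_rfl
  · exact Measure.le_add_right le_rfl

lemma iterInt_labelMeasure_ne_top (w : List Bool) : iterInt (labelMeasure p q) t w s ≠ ∞ :=
  ne_top_of_le_ne_top ENNReal.ofReal_ne_top (iterInt_labelMeasure_le w)

lemma pairInt_le (w : List Bool) :
    pairInt p q s t w ≤ expCoeff (p.real (Ioc s t) + q.real (Ioc s t)) w.length :=
  ENNReal.toReal_le_of_le_ofReal (expCoeff_nonneg (by positivity) _) (iterInt_labelMeasure_le w)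

lemma pairInt_split (hsc : s ≤ c) (hct : c ≤ t) :
    pairInt p q s t = wordConv (pairInt p q s c) (pairInt p q c t) := by
  ext w
  rw [pairInt, iterInt_split hsc hct, ENNReal.toReal_sum, wordConv]
  · simp [pairInt]
  · exact fun i _ => ENNReal.mul_ne_top (iterInt_labelMeasure_ne_top _)
      (iterInt_labelMeasure_ne_top _)

lemma pairInt_pair_self (b : Bool) :
    pairInt p q s t [b, b] = (labelMeasure p q b).real (Ioc s t) ^ 2 / 2 := by
  rw [pairInt, iterInt_congr (ν' := fun _ => labelMeasure p q b), iterInt_const_eq,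
    ENNReal.toReal_ofReal (expCoeff_nonneg measureReal_nonneg _)]
  · simp [expCoeff]
  · intro b' hb'
    simp at hb'
    rw [hb']

lemma pairInt_pair_split (hsc : s ≤ c) (hct : c ≤ t) (b b' : Bool) :
    pairInt p q s t [b, b'] = pairInt p q s c [b, b'] +
      pairInt p q s c [b] * pairInt p q c t [b'] + pairInt p q c t [b, b'] := by
  rw [pairInt_split hsc hct]
  simp [wordConv, Finset.sum_range_succ, pairInt, iterInt]
  ring

lemma pairInt_singleton_split (hsc : s ≤ c) (hct : c ≤ t) (b : Bool) :
    pairInt p q s t [b] = pairInt p q s c [b] + pairInt p q c t [b] := by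
  rw [pairInt_split hsc hct]
  simp [wordConv, Finset.sum_range_succ, pairInt, iterInt]
  ring

/-- Two words of length at most two are equally likely inside a mini-bucket. -/
lemma IsMiniBucket.pairInt_eq {k : ℕ} {ε : ℝ} (hε : 0 < ε) {a b : ℝ}
    (h : IsMiniBucket k ε p q a b) (w : List Bool) (hw : w.length < 3) :
    pairInt p q a b w = expCoeff (ε / k) w.length := by
  obtain ⟨u, v, hau, huv, hvb, hp1, hq1, hp2, hq2, hp3, hq3⟩ := h
  have rp1 : p.real (Ioc a u) = ε / k / 2 := by
    rw [measureReal_def, hp1, ENNReal.toReal_ofReal (by positivity)]; ring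
  have rp3 : p.real (Ioc v b) = ε / k / 2 := by
    rw [measureReal_def, hp3, ENNReal.toReal_ofReal (by positivity)]; ring
  have rq2 : q.real (Ioc u v) = ε / k := by
    rw [measureReal_def, hq2, ENNReal.toReal_ofReal (by positivity)]
  have rq1 : q.real (Ioc a u) = 0 := by rw [measureReal_def, hq1]; rfl
  have rp2 : p.real (Ioc u v) = 0 := by rw [measureReal_def, hp2]; rfl
  have rq3 : q.real (Ioc v b) = 0 := by rw [measureReal_def, hq3]; rfl
  have hub := huv.trans hvb
  match w, hw with
  | [], _ => simp [pairInt, iterInt, expCoeff]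
  | [x], _ =>
    rw [pairInt_singleton_split hau hub, pairInt_singleton_split huv hvb]
    cases x <;> simp [pairInt_singleton, labelMeasure, expCoeff, rp1, rp2, rp3, rq1, rq2, rq3]
  -- With `x = ε/k`, a mixed word pairs one outer `p`-mass `x/2` with the middle `q`-mass `x`,
  -- giving `x²/2`. Two `q` labels give `x²/2`, and two `p` labels give `2 (x/2)²/2 + (x/2)² =
  -- x²/2`.
  | [x, y], _ =>
    rw [pairInt_pair_split hau hub, pairInt_pair_split huv hvb, pairInt_singleton_split huv hvb]
    have e1 : ∀ x y, x = false ∨ y = false → pairInt p q a u [x, y] = 0 := by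
      rintro x y (rfl | rfl) <;> exact pairInt_pair_eq_zero (by simp [labelMeasure, hq1])
    have e2 : ∀ x y, x = true ∨ y = true → pairInt p q u v [x, y] = 0 := by
      rintro x y (rfl | rfl) <;> exact pairInt_pair_eq_zero (by simp [labelMeasure, hp2])
    have e3 : ∀ x y, x = false ∨ y = false → pairInt p q v b [x, y] = 0 := by
      rintro x y (rfl | rfl) <;> exact pairInt_pair_eq_zero (by simp [labelMeasure, hq3])
    cases x <;> cases y <;>
    simp [e1, e2, e3, pairInt_singleton, pairInt_pair_self, labelMeasure, expCoeff, rp1, rp2, rp3,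
      rq1, rq2, rq3] <;> ring

lemma IsBalanced.pairInt_le {x d : ℝ} (h : IsBalanced p q s t x d) (w : List Bool) :
    pairInt p q s t w ≤ expCoeff (2 * x) w.length := by
  have := _root_.pairInt_le (p := p) (q := q) (s := s) (t := t) w
  rwa [h.mass_left, h.mass_right, ← two_mul] at this

lemma measureReal_Ioc_add (μ : Measure ℝ) [IsFiniteMeasure μ] (hsc : s ≤ c) (hct : c ≤ t) :
    μ.real (Ioc s t) = μ.real (Ioc s c) + μ.real (Ioc c t) := by
  rw [← Ioc_union_Ioc_eq_Ioc hsc hct, measureReal_union (Ioc_disjoint_Ioc_of_le le_rfl)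
    measurableSet_Ioc]

lemma IsBalanced.trans {x y d e : ℝ} (h : IsBalanced p q s c x d) (hd : 0 ≤ d)
    (h' : IsBalanced p q c t y e) : IsBalanced p q s t (x + y) (d + e) where
  le := h.le.trans h'.le
  mass_left := by rw [measureReal_Ioc_add p h.le h'.le, h.mass_left, h'.mass_left]
  mass_right := by rw [measureReal_Ioc_add q h.le h'.le, h.mass_right, h'.mass_right]
  close := by
    rw [pairInt_split h.le h'.le]
    exact h.close.wordConv h.nonneg hd h'.close pairInt_nonneg h'.pairInt_le

/-- Short words contribute no error. For length `l + 3` the crude bound `(2ε/k) ^ (l + 3) / (l +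
3)!` suffices, since `l! ≤ (l + 3)!`. -/
lemma IsMiniBucket.isBalanced {k : ℕ} {ε : ℝ} (hε : 0 < ε) {a b : ℝ}
    (h : IsMiniBucket k ε p q a b) :
    IsBalanced p q a b (ε / k) ((2 * (ε / k)) ^ 3) := by
  have hp : p.real (Ioc a b) = ε / k := by
    simpa [pairInt_singleton, expCoeff, labelMeasure] using h.pairInt_eq hε [true]
  have hq : q.real (Ioc a b) = ε / k := by
    simpa [pairInt_singleton, expCoeff, labelMeasure] using h.pairInt_eq hε [false]
  refine ⟨?_, hp, hq, fun w => ?_⟩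
  · obtain ⟨u, v, h1, h2, h3, -⟩ := h
    exact h1.trans (h2.trans h3)
  · have hx : 0 ≤ ε / k := by positivity
    by_cases hw : w.length < 3
    · rw [h.pairInt_eq hε w hw, sub_self, abs_zero]
      exact mul_nonneg (by positivity) (shiftExpCoeff_nonneg (by positivity) _)
    · have h1 := pairInt_le (p := p) (q := q) (s := a) (t := b) w
      rw [hp, hq, ← two_mul] at h1
      have h2 : |pairInt p q a b w - expCoeff (ε / k) w.length| ≤
          expCoeff (2 * (ε / k)) w.length := by
        have h3 := expCoeff_mono hx (by linarith : ε / k ≤ 2 * (ε / k)) w.length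
        have h4 := expCoeff_nonneg hx w.length
        have h5 := pairInt_nonneg (p := p) (q := q) (s := a) (t := b) w
        rw [abs_le]; constructor <;> linarith
      refine h2.trans ?_
      rw [shiftExpCoeff, if_neg hw]
      obtain ⟨l, hl⟩ : ∃ l, w.length = l + 3 := ⟨w.length - 3, by omega⟩
      rw [hl, expCoeff, expCoeff, Nat.add_sub_cancel, mul_div_assoc' ((2 * (ε / k)) ^ 3),
        ← pow_add, add_comm 3]
      have : l.factorial ≤ (l + 3).factorial := Nat.factorial_le (by omega)
      exact div_le_div_of_nonneg_left (by positivity) (by positivity) (by exact_mod_cast this)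

lemma IsBucket.isBalanced {k : ℕ} {ε : ℝ} (hε : 0 < ε) (hε1 : ε ≤ 1) {a b : ℝ}
    (h : IsBucket k ε p q a b) :
    IsBalanced p q a b (1 / k) ((2 * (ε / k)) ^ 3) := by
  obtain ⟨c, hac, hcb, hm, hr, hp⟩ := h
  have rp : p.real (Ioc c b) = (1 - ε) / k := by
    rw [measureReal_def, hp,
      ENNReal.toReal_ofReal (div_nonneg (by linarith) (Nat.cast_nonneg _))]
  have rq : q.real (Ioc c b) = (1 - ε) / k := by
    rw [← rp, measureReal_def, measureReal_def, ← Measure.restrict_apply_univ, ← hr,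
      Measure.restrict_apply_univ]
  have hrest : IsBalanced p q c b ((1 - ε) / k) 0 := by
    refine ⟨hcb, rp, rq, fun w => ?_⟩
    rw [pairInt_eq_of_restrict_eq hr, rp]; simp
  have := (hm.isBalanced hε).trans (by positivity) hrest
  rwa [add_zero, ← add_div, add_sub_cancel] at this

/-- The error grows only linearly in `l`, while its order in the number of samples stays three; this
is what makes grouping profitable. -/
lemma isBalanced_of_buckets {k : ℕ} {ε : ℝ} (hε : 0 < ε) (hε1 : ε ≤ 1) {a : ℕ → ℝ}
    (h : ∀ j < k, IsBucket k ε p q (a j) (a (j + 1))) (i l : ℕ) (hil : i + l ≤ k) :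
    IsBalanced p q (a i) (a (i + l)) (l / k) (l * (2 * (ε / k)) ^ 3) := by
  induction l with
  | zero =>
    refine ⟨le_rfl, by simp, by simp, fun w => ?_⟩
    rw [pairInt_eq_of_restrict_eq (by simp)]
    simp
  | succ l ih =>
    have := (ih (by omega)).trans (by positivity) ((h (i + l) (by omega)).isBalanced hε hε1)
    rw [show ((l + 1 : ℕ) : ℝ) / k = l / k + 1 / k by push_cast; ring, Nat.cast_succ, add_mul,
      one_mul]
    exact this

end Buckets

/-! ### Sums over words and second moments of likelihood ratios. -/

section WordSums

lemma tsum_words (φ : List Bool → ℝ≥0∞) :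
    ∑' w, φ w = ∑' n, ∑ f : Fin n → Bool, φ (List.ofFn f) := by
  rw [← List.equivSigmaTuple.symm.tsum_eq, ENNReal.tsum_sigma' (β := fun n => Fin n → Bool)]
  simp only [tsum_fintype]
  rfl

lemma tsum_words_length (φ : ℕ → ℝ≥0∞) :
    ∑' w : List Bool, φ w.length = ∑' n, 2 ^ n * φ n := by
  rw [tsum_words]
  simp

/-- A word with a marked cut is determined by its two pieces. -/
lemma tsum_words_split_le (φ : List Bool → List Bool → ℝ≥0∞) :
    ∑' w : List Bool, ∑ i ∈ Finset.range (w.length + 1), φ (w.take i) (w.drop i) ≤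
      ∑' u, ∑' v, φ u v := by
  simp_rw [Finset.sum_range, ← tsum_fintype (L := .unconditional _)]
  rw [← ENNReal.tsum_sigma (β := fun w : List Bool => Fin (w.length + 1))
    fun w i => φ (w.take i) (w.drop i), ← ENNReal.tsum_prod]
  refine ENNReal.tsum_comp_le_tsum_of_injective
    (f := fun x : (w : List Bool) × Fin (w.length + 1) => (x.1.take x.2, x.1.drop x.2)) ?_
    fun x => φ x.1 x.2
  rintro ⟨w, i⟩ ⟨w', i'⟩ h
  simp only [Prod.mk.injEq] at h
  obtain rfl : w = w' := by
    rw [← List.take_append_drop i w, ← List.take_append_drop i' w', h.1, h.2]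
  have := congrArg List.length h.1
  simp only [List.length_take] at this
  congr 1
  ext
  omega

lemma tsum_ofReal_mul_expCoeff {c y : ℝ} (hc : 0 ≤ c) (hy : 0 ≤ y) :
    ∑' n, ENNReal.ofReal (c * expCoeff y n) = ENNReal.ofReal (c * Real.exp y) := by
  have h := (NormedSpace.expSeries_div_hasSum_exp y).mul_left c
  rw [← Real.exp_eq_exp_ℝ] at h
  rw [← h.tsum_eq, ENNReal.ofReal_tsum_of_nonneg _ h.summable]
  · rfl
  · exact fun n => mul_nonneg hc (expCoeff_nonneg hy n)

/-- The second moment of the likelihood ratio `F / H`. -/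
noncomputable def secondMoment (F H : List Bool → ℝ) : ℝ≥0∞ :=
  ∑' w, ENNReal.ofReal (F w ^ 2 / H w)

/-- This is data processing for the `χ²`-divergence: concatenation forgets the cut, and by
Cauchy–Schwarz the second moment cannot exceed that of the independent pair of pieces. -/
lemma secondMoment_wordConv_le {F F' H H' : List Bool → ℝ} (hH : ∀ w, 0 < H w)
    (hH' : ∀ w, 0 < H' w) :
    secondMoment (wordConv F F') (wordConv H H') ≤ secondMoment F H * secondMoment F' H' := by
  calc secondMoment (wordConv F F') (wordConv H H')
      ≤ ∑' w : List Bool, ∑ i ∈ Finset.range (w.length + 1),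
        ENNReal.ofReal (F (w.take i) ^ 2 / H (w.take i)) *
          ENNReal.ofReal (F' (w.drop i) ^ 2 / H' (w.drop i)) := by
        refine ENNReal.tsum_le_tsum fun w => ?_
        simp_rw [← ENNReal.ofReal_mul (div_nonneg (sq_nonneg (F _)) (hH _).le)]
        rw [← ENNReal.ofReal_sum_of_nonneg fun i _ => mul_nonneg
          (div_nonneg (sq_nonneg _) (hH _).le) (div_nonneg (sq_nonneg _) (hH' _).le)]
        refine ENNReal.ofReal_le_ofReal ((Finset.sq_sum_div_le_sum_sq_div _ _
          fun i _ => mul_pos (hH _) (hH' _)).trans_eq ?_)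
        exact Finset.sum_congr rfl fun i _ => by rw [mul_pow, mul_div_mul_comm]
    _ ≤ ∑' u, ∑' v, ENNReal.ofReal (F u ^ 2 / H u) * ENNReal.ofReal (F' v ^ 2 / H' v) :=
        tsum_words_split_le fun u v =>
          ENNReal.ofReal (F u ^ 2 / H u) * ENNReal.ofReal (F' v ^ 2 / H' v)
    _ = _ := by
        simp_rw [ENNReal.tsum_mul_left, ENNReal.tsum_mul_right]
        rfl

/-- The second moment of the likelihood ratio is one plus the `χ²`-divergence. -/
lemma secondMoment_add_tsum {F H : List Bool → ℝ} (hH : ∀ w, 0 < H w) (hF : ∀ w, 0 ≤ F w) :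
    secondMoment F H + ∑' w, ENNReal.ofReal (H w) =
      2 * ∑' w, ENNReal.ofReal (F w) + ∑' w, ENNReal.ofReal ((F w - H w) ^ 2 / H w) := by
  rw [secondMoment, ← ENNReal.tsum_add, ← ENNReal.tsum_mul_left, ← ENNReal.tsum_add]
  refine tsum_congr fun w => ?_
  have h1 := hH w
  have h2 := hF w
  rw [← ENNReal.ofReal_ofNat, ← ENNReal.ofReal_mul (by norm_num),
    ← ENNReal.ofReal_add (by positivity) (by positivity),
    ← ENNReal.ofReal_add (by positivity) (by positivity)]
  congr 1
  field_simp
  ring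

end WordSums

/-! ### Poisson weights on words. -/

section PoissonWeights

/-- The density of the label sequence of a Poisson sample of rate `m` from two measures of mass `x`
whose iterated integrals are `f`. -/
noncomputable def poissonWeight (m x : ℝ) (f : List Bool → ℝ) (w : List Bool) : ℝ :=
  Real.exp (-(2 * (m * x))) * m ^ w.length * f w

/-- The iterated integrals of two equal measures of mass `x`. -/
noncomputable def expWord (x : ℝ) (w : List Bool) : ℝ := expCoeff x w.length

lemma wordConv_expWord (x y : ℝ) : wordConv (expWord x) (expWord y) = expWord (x + y) :=
  funext fun w => wordConv_expCoeff x y w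

/-- This reflects the independence of Poisson samples on disjoint intervals, the reason for
Poissonizing. -/
lemma poissonWeight_wordConv (m x y : ℝ) (f g : List Bool → ℝ) :
    wordConv (poissonWeight m x f) (poissonWeight m y g) =
      poissonWeight m (x + y) (wordConv f g) := by
  ext w
  rw [wordConv, poissonWeight, wordConv, Finset.mul_sum]
  refine Finset.sum_congr rfl fun i hi => ?_
  have hi' : i ≤ w.length := Nat.lt_succ_iff.1 (Finset.mem_range.1 hi)
  have h1 : Real.exp (-(2 * (m * (x + y)))) =
      Real.exp (-(2 * (m * x))) * Real.exp (-(2 * (m * y))) := by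
    rw [← Real.exp_add]; ring_nf
  have h2 : m ^ w.length = m ^ (w.take i).length * m ^ (w.drop i).length := by
    rw [← pow_add, List.length_take, List.length_drop]
    congr 1
    omega
  rw [poissonWeight, poissonWeight, h1, h2]
  ring

lemma poissonWeight_expWord_pos {m x : ℝ} (hm : 0 < m) (hx : 0 < x) (w : List Bool) :
    0 < poissonWeight m x (expWord x) w := by
  unfold poissonWeight expWord expCoeff
  positivity

lemma tsum_poissonWeight_expWord {m x : ℝ} (hm : 0 ≤ m) (hx : 0 ≤ x) :
    ∑' w, ENNReal.ofReal (poissonWeight m x (expWord x) w) = 1 := by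
  refine (tsum_words_length fun n => ENNReal.ofReal
    (Real.exp (-(2 * (m * x))) * m ^ n * expCoeff x n)).trans ?_
  have : ∀ n : ℕ, 2 ^ n * ENNReal.ofReal (Real.exp (-(2 * (m * x))) * m ^ n * expCoeff x n) =
      ENNReal.ofReal (Real.exp (-(2 * (m * x))) * expCoeff (2 * (m * x)) n) := by
    intro n
    rw [← ENNReal.ofReal_ofNat, ← ENNReal.ofReal_pow (by norm_num),
      ← ENNReal.ofReal_mul (by positivity)]
    congr 1
    rw [expCoeff, expCoeff]
    ring
  simp_rw [this]
  rw [tsum_ofReal_mul_expCoeff (by positivity) (by positivity), ← Real.exp_add]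
  simp

end PoissonWeights

/-! ### Second moments of groups of buckets. -/

section Groups

variable {p q : Measure ℝ} [IsFiniteMeasure p] [IsFiniteMeasure q] [NullSingletonClass p]
  [NullSingletonClass q] {s c t : ℝ}

lemma sum_pairInt_ofFn (n : ℕ) : ∑ f : Fin n → Bool, pairInt p q s t (List.ofFn f) =
    expCoeff (p.real (Ioc s t) + q.real (Ioc s t)) n := by
  simp_rw [pairInt]
  rw [← ENNReal.toReal_sum fun f _ => iterInt_labelMeasure_ne_top _, sum_iterInt_ofFn]
  change (iterInt (fun _ => p + q) t (List.replicate n true) s).toReal = _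
  rw [iterInt_const_eq, measureReal_add_apply, List.length_replicate,
    ENNReal.toReal_ofReal (expCoeff_nonneg (by positivity) _)]

lemma IsBalanced.tsum_poissonWeight {x d m : ℝ} (h : IsBalanced p q s t x d) (hm : 0 ≤ m) :
    ∑' w, ENNReal.ofReal (poissonWeight m x (pairInt p q s t) w) = 1 := by
  have hx := h.nonneg
  rw [tsum_words]
  have : ∀ n : ℕ, ∑ f : Fin n → Bool,
      ENNReal.ofReal (poissonWeight m x (pairInt p q s t) (List.ofFn f)) =
      ENNReal.ofReal (Real.exp (-(2 * (m * x))) * expCoeff (2 * (m * x)) n) := by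
    intro n
    simp only [poissonWeight, List.length_ofFn]
    rw [← ENNReal.ofReal_sum_of_nonneg fun f _ =>
      mul_nonneg (by positivity) (pairInt_nonneg _)]
    rw [← Finset.mul_sum, sum_pairInt_ofFn, h.mass_left, h.mass_right, expCoeff, expCoeff]
    congr 1
    ring
  simp_rw [this]
  rw [tsum_ofReal_mul_expCoeff (by positivity) (by positivity), ← Real.exp_add]
  simp

/-- The contribution of a word of length `l + 3` to the `χ²`-divergence. -/
lemma sq_div_poissonWeight_le {x d m e D : ℝ} (hx : 0 < x) (hm : 0 < m) (he : 0 < e) (he1 : e ≤ 1)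
    (l : ℕ) (hD : |D| ≤ d * expCoeff (2 * x) l) :
    2 ^ (l + 3) * ((e * m ^ (l + 3) * D) ^ 2 / (e * m ^ (l + 3) * expCoeff x (l + 3))) ≤
      384 * d ^ 2 * (m / x) ^ 3 * expCoeff (16 * (m * x)) l := by
  have hD2 : D ^ 2 ≤ d ^ 2 * expCoeff (2 * x) l ^ 2 := by
    rw [← mul_pow, ← sq_abs]
    exact pow_le_pow_left₀ (abs_nonneg _) hD 2
  -- One of the two factors `l!` in the squared error is traded for `(l + 3)!`. The constants are
  -- `384 = 2³ · 2³ · 6`, and `16 = 2 · 4 · 2` from the word count, the squared rate `2 * x` and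
  -- this binomial bound.
  have hch : ((l + 3).factorial : ℝ) ≤ 2 ^ (l + 3) * l.factorial * 6 := by
    rw [← Nat.add_choose_mul_factorial_mul_factorial l 3]
    push_cast
    have : ((l + 3).choose 3 : ℝ) ≤ 2 ^ (l + 3) := by exact_mod_cast Nat.choose_le_two_pow _ _
    have h6 : ((Nat.factorial 3 : ℕ) : ℝ) = 6 := by norm_num [Nat.factorial]
    rw [h6]
    gcongr
  calc 2 ^ (l + 3) * ((e * m ^ (l + 3) * D) ^ 2 / (e * m ^ (l + 3) * expCoeff x (l + 3)))
      = (e * 2 ^ (l + 3) * m ^ (l + 3) / x ^ (l + 3)) * (D ^ 2 * (l + 3).factorial) := by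
        rw [expCoeff]; field_simp
    _ ≤ (1 * 2 ^ (l + 3) * m ^ (l + 3) / x ^ (l + 3)) *
        (d ^ 2 * expCoeff (2 * x) l ^ 2 * (2 ^ (l + 3) * l.factorial * 6)) := by
        gcongr
    _ = _ := by
        have h16 : (16 : ℝ) ^ l = 2 ^ l * 2 ^ l * 2 ^ l * 2 ^ l := by
          rw [← mul_pow, ← mul_pow, ← mul_pow]; norm_num
        rw [expCoeff, expCoeff, mul_pow 16, mul_pow m, mul_pow 2, h16]
        field_simp
        ring

/-- The second moment of the likelihood ratio on a balanced interval. -/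
lemma IsBalanced.secondMoment_le {x d m : ℝ} (h : IsBalanced p q s t x d) (hx : 0 < x)
    (hm : 0 < m) :
    secondMoment (poissonWeight m x (pairInt p q s t)) (poissonWeight m x (expWord x)) ≤
      1 + ENNReal.ofReal (384 * d ^ 2 * (m / x) ^ 3 * Real.exp (16 * (m * x))) := by
  have hpos := poissonWeight_expWord_pos hm hx
  have key := secondMoment_add_tsum (F := poissonWeight m x (pairInt p q s t)) hpos
    fun w => mul_nonneg (by positivity) (pairInt_nonneg w)
  rw [h.tsum_poissonWeight hm.le, tsum_poissonWeight_expWord hm.le hx.le, mul_one,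
    ← one_add_one_eq_two, add_right_comm] at key
  rw [WithTop.add_right_cancel ENNReal.one_ne_top key]
  gcongr
  set e := Real.exp (-(2 * (m * x)))
  have he1 : e ≤ 1 := Real.exp_le_one_iff.2 (by have := mul_pos hm hx; linarith)
  set ψ : ℕ → ℝ := fun n =>
    (e * m ^ n * (d * shiftExpCoeff (2 * x) n)) ^ 2 / (e * m ^ n * expCoeff x n) with hψ
  have hψle : ∀ w : List Bool, ENNReal.ofReal ((poissonWeight m x (pairInt p q s t) w -
      poissonWeight m x (expWord x) w) ^ 2 / poissonWeight m x (expWord x) w) ≤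
      ENNReal.ofReal (ψ w.length) := by
    intro w
    refine ENNReal.ofReal_le_ofReal ?_
    have := h.close w
    simp only [hψ, poissonWeight, expWord]
    rw [← mul_sub]
    refine div_le_div_of_nonneg_right ?_ (mul_nonneg (by positivity) (expCoeff_nonneg hx.le _))
    rw [mul_pow, mul_pow _ (d * _), ← sq_abs (pairInt _ _ _ _ _ - _)]
    gcongr
  refine (ENNReal.tsum_le_tsum hψle).trans ?_
  rw [tsum_words_length (fun n => ENNReal.ofReal (ψ n)), tsum_eq_zero_add' ENNReal.summable,
    tsum_eq_zero_add' ENNReal.summable, tsum_eq_zero_add' ENNReal.summable]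
  have h0 : ψ 0 = 0 ∧ ψ (0 + 1) = 0 ∧ ψ (0 + 1 + 1) = 0 := by simp [hψ, shiftExpCoeff]
  rw [h0.1, h0.2.1, h0.2.2]
  simp only [ENNReal.ofReal_zero, mul_zero, zero_add]
  rw [← tsum_ofReal_mul_expCoeff (by positivity) (by positivity)]
  refine ENNReal.tsum_le_tsum fun l => ?_
  rw [← ENNReal.ofReal_ofNat, ← ENNReal.ofReal_pow (by norm_num),
    ← ENNReal.ofReal_mul (by positivity)]
  refine ENNReal.ofReal_le_ofReal (sq_div_poissonWeight_le hx hm (Real.exp_pos _) he1 l ?_)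
  -- Nonnegativity of the bound is read off from closeness at a word of length `l + 3`.
  have hd : 0 ≤ d * expCoeff (2 * x) l := by
    have h3 := (abs_nonneg _).trans (h.close (List.replicate (l + 3) true))
    simpa [shiftExpCoeff] using h3
  simp only [shiftExpCoeff]
  rw [if_neg (by omega), abs_of_nonneg (by simpa using hd)]
  simp

/-- The second moments of consecutive balanced intervals multiply. -/
lemma secondMoment_trans_le {x y m : ℝ} (hm : 0 < m) (hx : 0 < x) (hy : 0 < y) (hsc : s ≤ c)
    (hct : c ≤ t) :
    secondMoment (poissonWeight m (x + y) (pairInt p q s t))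
      (poissonWeight m (x + y) (expWord (x + y))) ≤
    secondMoment (poissonWeight m x (pairInt p q s c)) (poissonWeight m x (expWord x)) *
      secondMoment (poissonWeight m y (pairInt p q c t)) (poissonWeight m y (expWord y)) := by
  rw [pairInt_split hsc hct, ← wordConv_expWord, ← poissonWeight_wordConv,
    ← poissonWeight_wordConv]
  exact secondMoment_wordConv_le (poissonWeight_expWord_pos hm hx)
    (poissonWeight_expWord_pos hm hy)

/-- The second moment of the likelihood ratio over all buckets, which are merged into `⌊m⌋₊` groups
of comparable size. -/
lemma secondMoment_buckets_le {k : ℕ} {ε m : ℝ} (hε : 0 < ε) (hε1 : ε ≤ 1) (hm : 1 ≤ m)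
    (hmk : m ≤ k) {a : ℕ → ℝ} (h : ∀ j < k, IsBucket k ε p q (a j) (a (j + 1))) :
    secondMoment (poissonWeight m 1 (pairInt p q (a 0) (a k))) (poissonWeight m 1 (expWord 1)) ≤
      ENNReal.ofReal (Real.exp (49152 * Real.exp 64 * (m ^ 5 * ε ^ 6 / k ^ 4))) := by
  have hm0 : 0 < m := by linarith
  have hk0 : (0 : ℝ) < k := by linarith
  set G := ⌊m⌋₊ with hG
  have hG1 : 1 ≤ G := Nat.le_floor (by simpa using hm)
  have hGm : (G : ℝ) ≤ m := Nat.floor_le hm0.le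
  have hmG : m ≤ 2 * G := by
    have := Nat.lt_floor_add_one m
    have h1 : (1 : ℝ) ≤ G := by exact_mod_cast hG1
    linarith
  have hGk : G ≤ k := by exact_mod_cast hGm.trans hmk
  -- The constant is `384 · (2³)² · 2`, the last factor coming from `k ≤ 2 m l`; the exponent is `16
  -- · 4`, from `m l ≤ 4 k`.
  set χ : ℝ := 49152 * Real.exp 64 * (m ^ 4 * ε ^ 6 / k ^ 4) with hχ
  have hχ0 : 0 ≤ χ := by positivity
  -- a single group of `l` buckets, with `l` comparable to `k / m`
  have group : ∀ i l : ℕ, i + l ≤ k → (k : ℝ) ≤ 2 * (m * l) → m * l ≤ 4 * k →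
      secondMoment (poissonWeight m (l / k) (pairInt p q (a i) (a (i + l))))
        (poissonWeight m (l / k) (expWord (l / k))) ≤ ENNReal.ofReal (1 + χ) := by
    intro i l hil h1 h2
    have hl : (0 : ℝ) < l := by nlinarith
    refine ((isBalanced_of_buckets hε hε1 h i l hil).secondMoment_le (by positivity) hm0).trans ?_
    rw [← ENNReal.ofReal_one, ← ENNReal.ofReal_add zero_le_one (by positivity)]
    refine ENNReal.ofReal_le_ofReal (add_le_add le_rfl ?_)
    have e1 : Real.exp (16 * (m * (l / k))) ≤ Real.exp 64 := by
      refine Real.exp_le_exp.2 ?_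
      have : m * (l / k) ≤ 4 := by rw [← mul_div_assoc, div_le_iff₀ hk0]; exact h2
      linarith
    calc 384 * (l * (2 * (ε / k)) ^ 3) ^ 2 * (m / (l / k)) ^ 3 * Real.exp (16 * (m * (l / k)))
        = 24576 * Real.exp (16 * (m * (l / k))) * (m ^ 4 * ε ^ 6 / k ^ 4) * (k / (m * l)) := by
          field_simp
          ring
      _ ≤ 24576 * Real.exp 64 * (m ^ 4 * ε ^ 6 / k ^ 4) * 2 := by
          gcongr
          rw [div_le_iff₀ (by positivity)]
          exact h1
      _ = χ := by rw [hχ]; ring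
  -- Group boundaries are equally spaced up to rounding; `G ≤ k` keeps every group nonempty.
  set b : ℕ → ℕ := fun i => i * k / G with hb
  have hbk : b G = k := Nat.mul_div_cancel_left k hG1
  have hbmono : Monotone b := fun i j hij => Nat.div_le_div_right (Nat.mul_le_mul_right k hij)
  have hsize : ∀ i < G, b i + (b (i + 1) - b i) ≤ k ∧
      (k : ℝ) ≤ 2 * (m * (b (i + 1) - b i : ℕ)) ∧ m * (b (i + 1) - b i : ℕ) ≤ 4 * k := by
    intro i hi
    have hmo : b i ≤ b (i + 1) := hbmono (Nat.le_succ i)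
    have hle : b (i + 1) ≤ k := hbk ▸ hbmono hi
    refine ⟨by omega, ?_⟩
    set l := b (i + 1) - b i with hl
    have d1 : G * b i ≤ i * k := Nat.mul_div_le _ _
    have d2 : i * k < G * b i + G := Nat.lt_mul_div_succ _ hG1 |>.trans_eq (by ring)
    have d3 : G * b (i + 1) ≤ (i + 1) * k := Nat.mul_div_le _ _
    have d4 : (i + 1) * k < G * b (i + 1) + G := Nat.lt_mul_div_succ _ hG1 |>.trans_eq (by ring)
    have hbl : b (i + 1) = b i + l := by omega
    rw [hbl] at d3 d4
    -- Rounding changes `G * l` by less than `G`. Together with `1 ≤ l` and `G ≤ k` this costs a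
    -- factor two, and `G ≤ m ≤ 2 G` then passes from `G` to `m`.
    have u1 : k < G * l + G := by nlinarith
    have u2 : G * l < k + G := by nlinarith
    have hl1 : 1 ≤ l := by
      by_contra hc
      have : l = 0 := by omega
      rw [this] at u1
      omega
    have u3 : k ≤ 2 * (G * l) := by nlinarith
    have u4 : G * l ≤ 2 * k := by omega
    have u3' : (k : ℝ) ≤ 2 * (G * l) := by exact_mod_cast u3
    have u4' : (G * l : ℝ) ≤ 2 * k := by exact_mod_cast u4
    have hl0 : (0 : ℝ) ≤ l := Nat.cast_nonneg l
    constructor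
    · nlinarith
    · nlinarith
  have hle : ∀ i j, i ≤ j → j ≤ k → a i ≤ a j := by
    intro i j hij hj
    obtain ⟨l, rfl⟩ := Nat.exists_eq_add_of_le hij
    exact (isBalanced_of_buckets hε hε1 h i l hj).le
  -- The induction starts at one because the reference weight of an interval of mass zero vanishes
  -- on nonempty words.
  have hind : ∀ i, 1 ≤ i → i ≤ G →
      secondMoment (poissonWeight m (b i / k) (pairInt p q (a 0) (a (b i))))
        (poissonWeight m (b i / k) (expWord (b i / k))) ≤ ENNReal.ofReal ((1 + χ) ^ i) := by
    intro i hi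
    induction i, hi using Nat.le_induction with
    | base =>
      intro _
      obtain ⟨s1, s2, s3⟩ := hsize 0 hG1
      have hb0 : b 0 = 0 := by simp [hb]
      simp only [hb0, zero_add, Nat.sub_zero] at s1 s2 s3
      have := group 0 (b 1) (by rwa [zero_add]) s2 s3
      rwa [zero_add, ← pow_one (1 + χ)] at this
    | succ i hi ih =>
      intro hiG
      obtain ⟨s1, s2, s3⟩ := hsize i hiG
      have hmo : b i ≤ b (i + 1) := hbmono (Nat.le_succ i)
      have hbl : b (i + 1) = b i + (b (i + 1) - b i) := by omega
      have g := group (b i) (b (i + 1) - b i) s1 s2 s3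
      set l := b (i + 1) - b i
      have hl0 : (0 : ℝ) < l := by nlinarith
      have hbi : (0 : ℝ) < b i := by
        have h1 : 1 ≤ b 1 := by
          rw [hb]
          exact (Nat.le_div_iff_mul_le hG1).2 (by simpa using hGk)
        exact_mod_cast h1.trans (hbmono hi)
      have := secondMoment_trans_le (p := p) (q := q) (x := b i / k) (y := l / k) hm0
        (by positivity) (by positivity) (hle 0 (b i) (Nat.zero_le _) (by omega))
        (hle (b i) (b i + l) (by omega) s1)
      rw [hbl]
      push_cast
      rw [add_div]
      refine this.trans ((mul_le_mul' (ih (by omega)) g).trans_eq ?_)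
      rw [← ENNReal.ofReal_mul (by positivity), pow_succ]
  have hfin := hind G hG1 le_rfl
  rw [hbk, div_self hk0.ne'] at hfin
  refine hfin.trans (ENNReal.ofReal_le_ofReal ?_)
  calc (1 + χ) ^ G ≤ Real.exp χ ^ G := by
        gcongr
        rw [add_comm]
        exact Real.add_one_le_exp χ
    _ = Real.exp (G * χ) := by rw [← Real.exp_nat_mul]
    _ ≤ Real.exp (m * χ) := by gcongr
    _ = _ := by rw [hχ]; congr 1; ring

end Groups

/-! ### Mutual information and the `χ²`-divergence. -/

section Divergence

lemma klFun_le_sq {x : ℝ} (hx : 0 ≤ x) : InformationTheory.klFun x ≤ (x - 1) ^ 2 := by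
  rw [InformationTheory.klFun_apply]
  rcases hx.eq_or_lt with rfl | hx
  · simp
  · nlinarith [Real.log_le_sub_one_of_pos hx]

/-- On a countable space, the Kullback-Leibler divergence is at most the `χ²`-divergence. -/
lemma klDiv_le_tsum {α : Type*} [MeasurableSpace α] [Countable α] [MeasurableSingletonClass α]
    (μ ν : Measure α) [IsProbabilityMeasure μ] [IsProbabilityMeasure ν] (h : ∀ a, ν {a} ≠ 0) :
    InformationTheory.klDiv μ ν ≤
      ∑' a, ENNReal.ofReal ((μ.real {a} - ν.real {a}) ^ 2 / ν.real {a}) := by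
  have hac : μ ≪ ν := by
    refine Measure.AbsolutelyContinuous.mk fun s _ hs => ?_
    have : s = ∅ := by
      rw [eq_empty_iff_forall_notMem]
      exact fun a ha => h a (measure_mono_null (singleton_subset_iff.2 ha) hs)
    simp [this]
  have hrn : ∀ a, (μ.rnDeriv ν a).toReal * ν.real {a} = μ.real {a} := by
    intro a
    have : μ {a} = μ.rnDeriv ν a * ν {a} := by
      conv_lhs => rw [← Measure.withDensity_rnDeriv_eq μ ν hac]
      rw [withDensity_apply _ (measurableSet_singleton a), lintegral_singleton]
    rw [measureReal_def, measureReal_def, this, ENNReal.toReal_mul]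
  rw [InformationTheory.klDiv_eq_lintegral_klFun_of_ac hac, lintegral_countable']
  refine ENNReal.tsum_le_tsum fun a => ?_
  have hpos : 0 < ν.real {a} := ENNReal.toReal_pos (h a) (measure_ne_top _ _)
  rw [← ofReal_measureReal, ← ENNReal.ofReal_mul
    (InformationTheory.klFun_nonneg ENNReal.toReal_nonneg)]
  refine ENNReal.ofReal_le_ofReal ?_
  rw [← hrn a]
  calc _ ≤ ((μ.rnDeriv ν a).toReal - 1) ^ 2 * ν.real {a} := by
        gcongr
        exact klFun_le_sq ENNReal.toReal_nonneg
    _ = _ := by field_simp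

/-- The mutual information of a uniform bit and a sample from one of two laws chosen by that bit. -/
lemma mutualInfo_mixture_le {α : Type*} [MeasurableSpace α] [Countable α]
    [MeasurableSingletonClass α] (P Q : Measure α) [IsProbabilityMeasure P]
    [IsProbabilityMeasure Q] (h : ∀ a, Q {a} ≠ 0) :
    mutualInfo ((2⁻¹ : ℝ≥0∞) • (Measure.dirac (0 : Fin 2)).prod P +
      (2⁻¹ : ℝ≥0∞) • (Measure.dirac (1 : Fin 2)).prod Q) ≤
      ∑' a, ENNReal.ofReal ((P.real {a} - Q.real {a}) ^ 2 / (2 * (P.real {a} + Q.real {a}))) := by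
  set μ := (2⁻¹ : ℝ≥0∞) • (Measure.dirac (0 : Fin 2)).prod P +
      (2⁻¹ : ℝ≥0∞) • (Measure.dirac (1 : Fin 2)).prod Q with hμ
  have hprob : IsProbabilityMeasure μ := ⟨by simp [hμ, ENNReal.inv_two_add_inv_two]⟩
  have hμs : ∀ (s : Set (Fin 2)) (t : Set α), μ (s ×ˢ t) =
      2⁻¹ * (Measure.dirac 0 s * P t) + 2⁻¹ * (Measure.dirac 1 s * Q t) := by
    intro s t
    simp [hμ, Measure.prod_prod]
  have hfst : ∀ i : Fin 2, μ.fst {i} = 2⁻¹ := by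
    intro i
    rw [Measure.fst_apply (measurableSet_singleton i), ← prod_univ, hμs]
    fin_cases i <;> simp
  have hsnd : ∀ a, μ.snd {a} = 2⁻¹ * (P {a} + Q {a}) := by
    intro a
    rw [Measure.snd_apply (measurableSet_singleton a), ← univ_prod, hμs]
    simp [mul_add]
  have hν : ∀ x : Fin 2 × α, (μ.fst.prod μ.snd) {x} = 2⁻¹ * (2⁻¹ * (P {x.2} + Q {x.2})) := by
    rintro ⟨i, a⟩
    rw [← singleton_prod_singleton, Measure.prod_prod, hfst, hsnd]
  have hνr : ∀ x : Fin 2 × α, (μ.fst.prod μ.snd).real {x} =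
      (P.real {x.2} + Q.real {x.2}) / 4 := by
    intro x
    rw [measureReal_def, hν, ENNReal.toReal_mul, ENNReal.toReal_mul,
      ENNReal.toReal_add (measure_ne_top _ _) (measure_ne_top _ _), ENNReal.toReal_inv]
    simp only [ENNReal.toReal_ofNat, measureReal_def]
    ring
  have hμ0 : ∀ a, μ.real {((0 : Fin 2), a)} = P.real {a} / 2 := by
    intro a
    rw [measureReal_def, ← singleton_prod_singleton, hμs]
    simp [measureReal_def]
    ring
  have hμ1 : ∀ a, μ.real {((1 : Fin 2), a)} = Q.real {a} / 2 := by
    intro a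
    rw [measureReal_def, ← singleton_prod_singleton, hμs]
    simp [measureReal_def]
    ring
  refine (klDiv_le_tsum μ (μ.fst.prod μ.snd) fun x => ?_).trans_eq ?_
  · rw [hν]
    simp [h]
  -- Each value of the bit contributes `(P - Q)² / (4 (P + Q))`.
  · rw [ENNReal.tsum_prod', tsum_fintype, Fin.sum_univ_two, ← ENNReal.tsum_add]
    refine tsum_congr fun a => ?_
    have hQ : 0 < Q.real {a} := ENNReal.toReal_pos (h a) (measure_ne_top _ _)
    have hP : 0 ≤ P.real {a} := measureReal_nonneg
    rw [hνr, hνr, hμ0, hμ1, ← ENNReal.ofReal_add (by positivity) (by positivity)]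
    congr 1
    field_simp
    ring

end Divergence

/-! ### Laws of label words as Poisson weights. -/

section LabelSequences

/-- If the iterated integrals are supported on `(s, t]`, they give the law of the label sequence. -/
lemma orderLaw_singleton_eq_poissonWeight (m : ℝ≥0) (p q : Measure ℝ) [IsProbabilityMeasure p]
    [IsProbabilityMeasure q] [NullSingletonClass p] [NullSingletonClass q] {s t : ℝ}
    (hp : p.real (Ioc s t) = 1) (hq : q.real (Ioc s t) = 1) (w : List Bool) :
    orderLaw m p q {w} = ENNReal.ofReal (poissonWeight m 1 (pairInt p q s t) w) := by
  have hprob : ∀ b, IsProbabilityMeasure (labelMeasure p q b) := by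
    intro b; cases b <;> simpa [labelMeasure]
  have hae : ∀ b, ∀ᵐ x ∂labelMeasure p q b, x ∈ Ioc s t := by
    intro b
    refine (prob_compl_eq_zero_iff measurableSet_Ioc).2 ?_
    rw [← ofReal_measureReal]
    cases b
    · rw [labelMeasure, if_neg Bool.false_ne_true, hq, ENNReal.ofReal_one]
    · rw [labelMeasure, if_pos rfl, hp, ENNReal.ofReal_one]
  have hpi : Measure.pi (fun i : Fin w.length => labelMeasure p q (w.get i)) {z | StrictMono z} =
      iterInt (labelMeasure p q) t w s := by
    rw [← pi_strictMono_Ioc]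
    refine measure_congr ?_
    have : ∀ᵐ z ∂Measure.pi (fun i : Fin w.length => labelMeasure p q (w.get i)),
        ∀ i, z i ∈ Ioc s t := by
      rw [ae_all_iff]
      intro i
      exact (measurePreserving_eval (fun i : Fin w.length => labelMeasure p q (w.get i))
        i).quasiMeasurePreserving.ae (hae _)
    filter_upwards [this] with z hz
    exact propext ⟨fun h => ⟨h, hz⟩, fun h => h.1⟩
  rw [orderLaw_singleton, hpi, poissonWeight, pairInt, mul_one,
    ENNReal.ofReal_mul (q := ENNReal.toReal _) (by positivity),
    ENNReal.ofReal_toReal (iterInt_labelMeasure_ne_top w)]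

/-- Under equal distributions all label sequences of the same length are equally likely. -/
lemma orderLaw_self_singleton (m : ℝ≥0) (r : Measure ℝ) [IsProbabilityMeasure r]
    [NullSingletonClass r] (w : List Bool) :
    orderLaw m r r {w} = ENNReal.ofReal (poissonWeight m 1 (expWord 1) w) := by
  have h := pi_const_strictMono w.length r
  rw [measure_univ, one_pow] at h
  have hr : (fun i : Fin w.length => labelMeasure r r (w.get i)) = fun _ => r := by
    ext1 i; simp [labelMeasure]
  rw [orderLaw_singleton, hr, ENNReal.eq_inv_of_mul_eq_one_left h, poissonWeight, expWord,
    expCoeff, mul_one, one_pow, one_div, ENNReal.ofReal_mul (q := _⁻¹) (by positivity),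
    ENNReal.ofReal_inv_of_pos (by positivity), ENNReal.ofReal_natCast]

end LabelSequences

/-! ### The bound on the mutual information. -/

theorem mainTheorem7 :
    ∃ C : ℝ, 0 < C ∧
      ∀ (k : ℕ) (ε : ℝ) (m : ℝ≥0), 0 < ε → ε ≤ 1 → 1 ≤ m → m ≤ (k : ℝ≥0) →
      ∀ (p q r : Measure ℝ) [IsProbabilityMeasure p] [IsProbabilityMeasure q]
        [IsProbabilityMeasure r] [NullSingletonClass p] [NullSingletonClass q] [NullSingletonClass r],
        IsBucketPair k ε p q →
        mutualInfo (jointLaw m p q r) ≤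
          ENNReal.ofReal (C * ((m : ℝ) ^ 5 * ε ^ 6 / (k : ℝ) ^ 4)) := by
  refine ⟨49152 * Real.exp 64, by positivity, ?_⟩
  intro k ε m hε hε1 hm1 hmk p q r _ _ _ _ _ _ ⟨a, ha⟩
  have hm1' : (1 : ℝ) ≤ m := by exact_mod_cast hm1
  have hmk' : (m : ℝ) ≤ k := by exact_mod_cast hmk
  have hm0 : (0 : ℝ) < m := by linarith
  have hk0 : (0 : ℝ) < k := by linarith
  -- `Fin.ofNat` wraps around modulo `k + 1`, but only the indices `0, …, k` are used.
  set a' : ℕ → ℝ := fun j => a (Fin.ofNat (k + 1) j) with ha'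
  have hbucket : ∀ j < k, IsBucket k ε p q (a' j) (a' (j + 1)) := by
    intro j hj
    have h1 : Fin.ofNat (k + 1) j = (⟨j, hj⟩ : Fin k).castSucc := by
      ext; simp [Nat.mod_eq_of_lt (show j < k + 1 by omega)]
    have h2 : Fin.ofNat (k + 1) (j + 1) = (⟨j, hj⟩ : Fin k).succ := by
      ext; simp [hj]
    rw [ha']
    simp only [h1, h2]
    exact ha ⟨j, hj⟩
  have hbal := isBalanced_of_buckets hε hε1 hbucket 0 k (by omega)
  rw [zero_add, div_self hk0.ne'] at hbal
  set F := poissonWeight m 1 (pairInt p q (a' 0) (a' k)) with hF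
  set H := poissonWeight m 1 (expWord 1) with hH
  have hHpos : ∀ w, 0 < H w := poissonWeight_expWord_pos hm0 one_pos
  have hF0 : ∀ w, 0 ≤ F w := fun w => mul_nonneg (by positivity) (pairInt_nonneg w)
  have hP : ∀ w, (orderLaw m p q).real {w} = F w := by
    intro w
    rw [measureReal_def, orderLaw_singleton_eq_poissonWeight m p q hbal.mass_left hbal.mass_right,
      ENNReal.toReal_ofReal (hF0 w)]
  have hQ : ∀ w, (orderLaw m r r).real {w} = H w := by
    intro w
    rw [measureReal_def, orderLaw_self_singleton, ENNReal.toReal_ofReal (hHpos w).le]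
  have hI := mutualInfo_mixture_le (orderLaw m p q) (orderLaw m r r) (by
    intro w
    rw [orderLaw_self_singleton]
    exact (ENNReal.ofReal_pos.2 (hHpos w)).ne')
  simp only [hP, hQ] at hI
  set χ := 49152 * Real.exp 64 * ((m : ℝ) ^ 5 * ε ^ 6 / (k : ℝ) ^ 4) with hχ
  have hχ0 : 0 ≤ χ := by positivity
  have sumF : ∑' w, ENNReal.ofReal (F w) = 1 := hbal.tsum_poissonWeight hm0.le
  have sumH : ∑' w, ENNReal.ofReal (H w) = 1 := tsum_poissonWeight_expWord hm0.le zero_le_one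
  refine hI.trans ?_
  -- For `χ ≥ 1` the symmetrized divergence is at most one anyway. For `χ ≤ 1`, `exp χ ≤ 1 + 2 χ`,
  -- and this factor two is cancelled by the `1/2` left after dropping `F` from the denominator.
  rcases le_total 1 χ with hχ1 | hχ1
  · calc ∑' w, ENNReal.ofReal ((F w - H w) ^ 2 / (2 * (F w + H w)))
        ≤ ∑' w, ENNReal.ofReal 2⁻¹ * (ENNReal.ofReal (F w) + ENNReal.ofReal (H w)) := by
          refine ENNReal.tsum_le_tsum fun w => ?_
          rw [← ENNReal.ofReal_add (hF0 w) (hHpos w).le, ← ENNReal.ofReal_mul (by norm_num)]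
          refine ENNReal.ofReal_le_ofReal ?_
          have h1 := hF0 w
          have h2 := hHpos w
          rw [div_le_iff₀ (by positivity)]
          nlinarith
      _ = 1 := by
          rw [ENNReal.tsum_mul_left, ENNReal.tsum_add, sumF, sumH, ← ENNReal.ofReal_one,
            ← ENNReal.ofReal_add zero_le_one zero_le_one, ← ENNReal.ofReal_mul (by norm_num)]
          norm_num
      _ ≤ ENNReal.ofReal χ := ENNReal.one_le_ofReal.2 hχ1
  · have hS : secondMoment F H ≤ ENNReal.ofReal (Real.exp χ) :=
      secondMoment_buckets_le hε hε1 hm1' hmk' hbucket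
    have key := secondMoment_add_tsum hHpos hF0
    rw [sumF, sumH, mul_one, ← one_add_one_eq_two, add_right_comm] at key
    rw [WithTop.add_right_cancel ENNReal.one_ne_top key] at hS
    have hexp : Real.exp χ ≤ 1 + 2 * χ := by
      have := Real.abs_exp_sub_one_le (x := χ) (by rwa [abs_of_nonneg hχ0])
      rw [abs_of_nonneg hχ0] at this
      linarith [le_abs_self (Real.exp χ - 1)]
    have hD : ∑' w, ENNReal.ofReal ((F w - H w) ^ 2 / H w) ≤ ENNReal.ofReal (2 * χ) := by
      have := hS.trans (ENNReal.ofReal_le_ofReal hexp)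
      rw [ENNReal.ofReal_add zero_le_one (by positivity), ENNReal.ofReal_one] at this
      exact (ENNReal.add_le_add_iff_left ENNReal.one_ne_top).1 this
    calc ∑' w, ENNReal.ofReal ((F w - H w) ^ 2 / (2 * (F w + H w)))
        ≤ ∑' w, ENNReal.ofReal 2⁻¹ * ENNReal.ofReal ((F w - H w) ^ 2 / H w) := by
          refine ENNReal.tsum_le_tsum fun w => ?_
          rw [← ENNReal.ofReal_mul (by norm_num)]
          refine ENNReal.ofReal_le_ofReal ?_
          have h1 := hF0 w
          have h2 := hHpos w
          rw [← div_eq_inv_mul, div_div, mul_comm (H w)]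
          gcongr
          linarith
      _ ≤ ENNReal.ofReal 2⁻¹ * ENNReal.ofReal (2 * χ) := by
          rw [ENNReal.tsum_mul_left]
          gcongr
      _ = ENNReal.ofReal χ := by
          rw [← ENNReal.ofReal_mul (by norm_num)]
          congr 1
          ring
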